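/- For $x,y\in\mathbb R$ let $d(x,y)=\min_{n\in\mathbb Z}|x-y-n|$ be the wrap-around distance, and for a finite set $T\subset(-\tfrac12,\tfrac12)$ let $\Delta(T)=\min\{d(s,t): s,t\in T,\ s\neq t\}$ (with $\Delta(T)=\infty$ if $T$ has at most one point). For $L>0$ and $\rho>0$ let $$h_\rho(x)=\Big(\frac{L}{2\rho}\Big)^{1/2}\frac{\sin(\pi\rho x/L)}{\pi x}\quad(x\neq0),\qquad h_\rho(0)=\Big(\frac{\rho}{2L}\Big)^{1/2}.$$ Let $L>0$, let $m\ge1$ be an integer, and let $T=\{x_1,\dots,x_s\}\subset(-\tfrac12,\tfrac12)$ be finite with $\Delta(T)\ge \frac5m$. Then there is $\rho_0>0$ such that for every $0<\rho\le\rho_0$ and every choice of $\omega_1,\dots,\omega_s\in\mathbb C$ with $|\omega_k|=1$ (in particular, for $\omega_1=\dots=\omega_s=1$) there exists a trigonometric polynomial of degree at most $m$, $$q^\rho(x)=\sum_{k=-m}^m c_k e^{2\pi i kx},\qquad c_k\in\mathbb C,$$ such that the function $g=q^\rho h_\rho$ on $\mathbb R$ satisfies $$g(x_k)=\omega_k\quad\text{for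 all }k,$$ $$|g(x)|\le 1-0.34\,m^2\,d(x,x_k)^2\quad\text{for all }k\text{ and all }x\in\mathbb R\text{ with } d(x,x_k)\le \frac{0.16749}{m},$$ $$|g(x)|\le 1-0.34\cdot 0.16749^2\quad\text{for all }x\in\mathbb R\text{ with } d(x,x_k)>\frac{0.16749}{m}\text{ for every }k.$$ -/

import Mathlib

/-- The window `h_ρ(x) = (L / (2ρ))^{1/2} · sin(π ρ x / L) / (π x)`, extended continuously to
`x = 0`; see `bandWindow_eq` for the displayed formula. -/
noncomputable def bandWindow (L ρ x : ℝ) : ℝ :=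
  Real.sqrt (ρ / (2 * L)) * Real.sinc (Real.pi * ρ * x / L)

theorem bandWindow_eq {L ρ x : ℝ} (hL : 0 < L) (hρ : 0 < ρ) (hx : x ≠ 0) :
    bandWindow L ρ x =
      Real.sqrt (L / (2 * ρ)) * (Real.sin (Real.pi * ρ * x / L) / (Real.pi * x)) := by
  have hne : Real.pi * ρ * x / L ≠ 0 := by
    have := Real.pi_ne_zero
    positivity
  have hs : Real.sqrt (ρ / (2 * L)) = Real.sqrt (L / (2 * ρ)) * (ρ / L) := by
    rw [← Real.sqrt_sq (by positivity : (0 : ℝ) ≤ ρ / L), ← Real.sqrt_mul (by positivity)]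
    congr 1
    field_simp
  have hp := Real.pi_ne_zero
  rw [bandWindow, Real.sinc_of_ne_zero hne, hs]
  field_simp

/-- The wrap-around distance on `ℝ / ℤ`, i.e. the distance of `x - y` to the nearest integer. -/
noncomputable def wrapDist (x y : ℝ) : ℝ := dist (x : UnitAddCircle) (y : UnitAddCircle)

theorem wrapDist_eq (x y : ℝ) : wrapDist x y = |x - y - round (x - y)| := by
  rw [wrapDist, dist_eq_norm, ← AddCircle.coe_sub, UnitAddCircle.norm_eq]

/-- The minimal separation `Δ(T) = inf {d(s, t) : s, t ∈ T, s ≠ t}` for the wrap-around distance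
`d`, equal to `∞` if `T` has at most one point. -/
noncomputable def minSeparation (T : Finset ℝ) : ENNReal :=
  ⨅ s ∈ T, ⨅ t ∈ T, ⨅ _ : s ≠ t, ENNReal.ofReal (wrapDist s t)

/-- `q` is a (complex, one-periodic) trigonometric polynomial of degree at most `m`. -/
def IsTrigPoly (m : ℕ) (q : ℝ → ℂ) : Prop :=
  ∃ c : ℤ → ℂ, ∀ x : ℝ,
    q x = ∑ k ∈ Finset.Icc (-(m : ℤ)) (m : ℤ),
      c k * Complex.exp (2 * Real.pi * Complex.I * k * x)

/-!
# Interpolating arbitrary phases by window-modulated trigonometric polynomials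

The polynomial is a Hermite interpolant `q x = ∑ k, (a k * K (m * (x - k)) + b k * K' (m * (x - k)))`
built from translates of a kernel `K` and of its derivative. In the rescaled variable `u = m * x` the
kernel is a cosine sum with nonnegative coefficients and frequencies at most `2 * π`, so its shape
near the peak (curvature, monotonicity, size of derivatives) can be read off from that of the cosine
(`cosSum_two_le`, `cosSum_zero_le_one_sub`, `cosSum_zero_le_cosSum_zero`).

If `m ≥ 10`, the kernel is the fourth power of a normalized Dirichlet kernel. Then `K` and its first
three derivatives decay like `u ^ (-4)` with explicit constants (`exists_cosKernel_decay`). For nodes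
at mutual distance `5 / m` the contributions of all nodes but the closest are therefore small
(`sum_inv_wrapDist_pow_four_le`), the linear system for the coefficients is diagonally dominant
(`exists_hermite_solution`), each `a k` is close to the prescribed phase and each `b k` is close to
zero. If `m ≤ 9`, there is at most one node, and `cos (π * x) ^ (2 * m)` serves as kernel. In both
cases `q` has near each node a second derivative pointing against the phase, and stays clear of the
unit circle elsewhere (`IsPeakInterpolant`).

The window is, up to a constant, `sinc (c * x)` with `c = π * ρ / L`, and for small `ρ` it is close
to `1`, with small first and second derivatives, on bounded sets. The values and slopes of `q` are
chosen so that the product with the window has the prescribed phases as values, and slope zero, at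
the nodes; since the estimates for `q` have some slack, the product has a quadratic peak in modulus
at each node (`IsPeakInterpolant.norm_mul_sinc_le`). This settles the points near a node itself. The
window is not periodic, so points near the integer translates of a node are compared with the
corresponding point near the node: either that point lies in `[-1/2, 1/2]`, where the window is
largest among all translates, or it has a definite distance from the node, and the slack suffices.
-/

open Filter Topology

/-! ### Taylor estimates and the function `sinc` -/

/-- A function on `[-r, r]` with a critical point at `0` and nonpositive second derivative has its
maximum at `0`. -/
theorem le_apply_zero_of_second_deriv_nonpos {f f1 f2 : ℝ → ℝ} {r : ℝ}
    (h1 : ∀ u, |u| ≤ r → HasDerivAt f (f1 u) u) (h2 : ∀ u, |u| ≤ r → HasDerivAt f1 (f2 u) u)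
    (h0 : f1 0 = 0) (hneg : ∀ u, |u| ≤ r → f2 u ≤ 0) {u : ℝ} (hu : |u| ≤ r) : f u ≤ f 0 := by
  have hr : 0 ≤ r := (abs_nonneg u).trans hu
  have hmem : ∀ {v : ℝ}, v ∈ Set.Icc (-r) r → |v| ≤ r := fun hv => abs_le.2 hv
  have hanti : AntitoneOn f1 (Set.Icc (-r) r) := by
    refine antitoneOn_of_deriv_nonpos (convex_Icc _ _)
      (fun v hv => (h2 v (hmem hv)).continuousAt.continuousWithinAt)
      (fun v hv => (h2 v (hmem (interior_subset hv))).differentiableAt.differentiableWithinAt)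
      (fun v hv => ?_)
    rw [(h2 v (hmem (interior_subset hv))).deriv]
    exact hneg v (hmem (interior_subset hv))
  have hz : (0 : ℝ) ∈ Set.Icc (-r) r := ⟨by linarith, hr⟩
  obtain ⟨hu1, hu2⟩ := abs_le.1 hu
  rcases le_total 0 u with hpos | hneg'
  · have hf : AntitoneOn f (Set.Icc 0 r) := by
      have hm : ∀ v ∈ Set.Icc 0 r, v ∈ Set.Icc (-r) r := fun v hv => ⟨by linarith [hv.1], hv.2⟩
      refine antitoneOn_of_deriv_nonpos (convex_Icc _ _)
        (fun v hv => (h1 v (hmem (hm v hv))).continuousAt.continuousWithinAt)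
        (fun v hv => (h1 v (hmem (hm v (interior_subset
          hv)))).differentiableAt.differentiableWithinAt)
        (fun v hv => ?_)
      have hv' := interior_subset hv
      rw [(h1 v (hmem (hm v hv'))).deriv, ← h0]
      exact hanti hz (hm v hv') hv'.1
    exact hf ⟨le_refl _, hr⟩ ⟨hpos, hu2⟩ hpos
  · have hf : MonotoneOn f (Set.Icc (-r) 0) := by
      have hm : ∀ v ∈ Set.Icc (-r) 0, v ∈ Set.Icc (-r) r := fun v hv => ⟨hv.1, by linarith [hv.2]⟩
      refine monotoneOn_of_deriv_nonneg (convex_Icc _ _)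
        (fun v hv => (h1 v (hmem (hm v hv))).continuousAt.continuousWithinAt)
        (fun v hv => (h1 v (hmem (hm v (interior_subset
          hv)))).differentiableAt.differentiableWithinAt)
        (fun v hv => ?_)
      have hv' := interior_subset hv
      rw [(h1 v (hmem (hm v hv'))).deriv, ← h0]
      exact hanti (hm v hv') hz hv'.2
    exact hf ⟨hu1, hneg'⟩ ⟨by linarith, le_refl _⟩ hneg'

theorem le_add_sq_of_second_deriv_le {f f1 f2 : ℝ → ℝ} {r B : ℝ}
    (h1 : ∀ u, |u| ≤ r → HasDerivAt f (f1 u) u) (h2 : ∀ u, |u| ≤ r → HasDerivAt f1 (f2 u) u)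
    (h0 : f1 0 = 0) (hB : ∀ u, |u| ≤ r → f2 u ≤ B) {u : ℝ} (hu : |u| ≤ r) :
    f u ≤ f 0 + B / 2 * u ^ 2 := by
  have key := le_apply_zero_of_second_deriv_nonpos (f := fun v => f v - B / 2 * v ^ 2)
    (f1 := fun v => f1 v - B * v) (f2 := fun v => f2 v - B) (r := r)
    (fun v hv => ?_) (fun v hv => ?_) (by simp [h0]) (fun v hv => by linarith [hB v hv]) hu
  · linarith
  · refine ((h1 v hv).fun_sub ((hasDerivAt_pow 2 v).const_mul (B / 2))).congr_deriv ?_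
    push_cast
    ring
  · refine ((h2 v hv).fun_sub ((hasDerivAt_id v).const_mul B)).congr_deriv ?_
    ring

/-- A complex-valued function with `f 0 = ω` on the unit circle and `f' 0 = 0` has a quadratic peak
in modulus at `0` as soon as `conj ω * f''` has sufficiently negative real part:
the real part of `conj ω * f` then falls below `1` quadratically, and its imaginary part enters the
squared modulus only in the fourth order. -/
theorem norm_le_one_sub_sq {f f1 f2 : ℝ → ℂ} {ω : ℂ} (hω : ‖ω‖ = 1)
    (h1 : ∀ u : ℝ, |u| ≤ 0.16749 → HasDerivAt f (f1 u) u)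
    (h2 : ∀ u : ℝ, |u| ≤ 0.16749 → HasDerivAt f1 (f2 u) u)
    (hf0 : f 0 = ω) (hf1 : f1 0 = 0)
    (hre : ∀ u : ℝ, |u| ≤ 0.16749 → (starRingEnd ℂ ω * f2 u).re ≤ -0.97)
    (him : ∀ u : ℝ, |u| ≤ 0.16749 → |(starRingEnd ℂ ω * f2 u).im| ≤ 0.66)
    (hn : ∀ u : ℝ, |u| ≤ 0.16749 → ‖f2 u‖ ≤ 22) {u : ℝ} (hu : |u| ≤ 0.16749) :
    ‖f u‖ ≤ 1 - 0.35 * u ^ 2 := by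
  set c := starRingEnd ℂ ω with hc
  have hcn : ‖c‖ = 1 := by rw [hc, RCLike.norm_conj, hω]
  have hcω : c * ω = 1 := by
    rw [mul_comm, hc, Complex.mul_conj, Complex.normSq_eq_norm_sq, hω]
    norm_num
  have d1 : ∀ v : ℝ, |v| ≤ 0.16749 → HasDerivAt (fun x => c * f x) (c * f1 v) v :=
    fun v hv => (h1 v hv).const_mul c
  have d2 : ∀ v : ℝ, |v| ≤ 0.16749 → HasDerivAt (fun x => c * f1 x) (c * f2 v) v :=
    fun v hv => (h2 v hv).const_mul c
  have re' : ∀ {g : ℝ → ℂ} {g' : ℂ} {v : ℝ}, HasDerivAt g g' v →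
      HasDerivAt (fun x => (g x).re) g'.re v := fun {g g' v} hg => by
    exact Complex.reCLM.hasFDerivAt.comp_hasDerivAt v hg
  have im' : ∀ {g : ℝ → ℂ} {g' : ℂ} {v : ℝ}, HasDerivAt g g' v →
      HasDerivAt (fun x => (g x).im) g'.im v := fun {g g' v} hg => by
    exact Complex.imCLM.hasFDerivAt.comp_hasDerivAt v hg
  have b1 := le_add_sq_of_second_deriv_le (fun v hv => re' (d1 v hv)) (fun v hv => re' (d2 v hv))
    (by simp [hf1]) hre hu
  have b2 := le_add_sq_of_second_deriv_le (fun v hv => (re' (d1 v hv)).neg)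
    (fun v hv => (re' (d2 v hv)).neg) (by simp [hf1]) (B := 22) (fun v hv => by
      have h3 := (Complex.abs_re_le_norm (c * f2 v))
      rw [norm_mul, hcn, one_mul] at h3
      linarith [neg_abs_le (c * f2 v).re, hn v hv]) hu
  have b3 := le_add_sq_of_second_deriv_le (fun v hv => im' (d1 v hv)) (fun v hv => im' (d2 v hv))
    (by simp [hf1]) (fun v hv => (abs_le.1 (him v hv)).2) hu
  have b4 := le_add_sq_of_second_deriv_le (fun v hv => (im' (d1 v hv)).neg)
    (fun v hv => (im' (d2 v hv)).neg) (by simp [hf1]) (B := 0.66) (fun v hv => by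
      linarith [(abs_le.1 (him v hv)).1]) hu
  simp only [Pi.neg_apply, hf0, hcω, Complex.one_re, Complex.one_im] at b1 b2 b3 b4
  have hu2 : u ^ 2 ≤ 0.0281 := by
    have := mul_self_le_mul_self (abs_nonneg u) hu
    rw [abs_mul_abs_self] at this
    nlinarith
  have hnn := sq_nonneg u
  have hnorm : ‖f u‖ ^ 2 = (c * f u).re ^ 2 + (c * f u).im ^ 2 := by
    have : ‖f u‖ = ‖c * f u‖ := by rw [norm_mul, hcn, one_mul]
    rw [this, ← Complex.normSq_eq_norm_sq, Complex.normSq_apply]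
    ring
  have hre2 : (c * f u).re ^ 2 ≤ (1 - 0.485 * u ^ 2) ^ 2 :=
    pow_le_pow_left₀ (by linarith) (by linarith) 2
  have him2 : (c * f u).im ^ 2 ≤ (0.33 * u ^ 2) ^ 2 :=
    sq_le_sq' (by linarith) (by linarith)
  refine le_of_sq_le_sq ?_ (by linarith)
  rw [hnorm]
  nlinarith

theorem sinc_eq_integral (z : ℝ) : Real.sinc z = ∫ v in (0 : ℝ)..1, Real.cos (z * v) := by
  rcases eq_or_ne z 0 with rfl | hz
  · simp
  · rw [Real.sinc_of_ne_zero hz, intervalIntegral.integral_comp_mul_left _ hz]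
    simp [div_eq_inv_mul]

/-- The first derivative of `sinc`. -/
noncomputable def sincDeriv (z : ℝ) : ℝ := ∫ v in (0 : ℝ)..1, -(v * Real.sin (z * v))

/-- The second derivative of `sinc`. -/
noncomputable def sincDeriv2 (z : ℝ) : ℝ := ∫ v in (0 : ℝ)..1, -(v * v * Real.cos (z * v))

theorem hasDerivAt_sinc (z : ℝ) : HasDerivAt Real.sinc (sincDeriv z) z := by
  have h := (intervalIntegral.hasDerivAt_integral_of_dominated_loc_of_deriv_le (a := 0) (b := 1)
    (μ := MeasureTheory.volume) (F := fun z v : ℝ => Real.cos (z * v))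
    (F' := fun z v : ℝ => -(v * Real.sin (z * v))) (x₀ := z) (s := Set.univ)
    (bound := fun _ => 1) Filter.univ_mem
    (Eventually.of_forall fun x => by fun_prop)
    (Continuous.intervalIntegrable (by fun_prop) _ _) (by fun_prop)
    (Eventually.of_forall fun v hv x _ => ?_) (by simp)
    (Eventually.of_forall fun v hv x _ => ?_)).2
  · rwa [show (fun z : ℝ => ∫ v in (0 : ℝ)..1, Real.cos (z * v)) = Real.sinc from
      funext fun z => (sinc_eq_integral z).symm] at h
  · rw [Set.uIoc_of_le zero_le_one] at hv
    rw [norm_neg, norm_mul, Real.norm_eq_abs, Real.norm_eq_abs]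
    exact mul_le_one₀ (by rw [abs_of_pos hv.1]; exact hv.2) (abs_nonneg _) (Real.abs_sin_le_one _)
  · refine ((hasDerivAt_id x).mul_const v).cos.congr_deriv ?_
    simp [mul_comm]

theorem hasDerivAt_sincDeriv (z : ℝ) : HasDerivAt sincDeriv (sincDeriv2 z) z := by
  refine (intervalIntegral.hasDerivAt_integral_of_dominated_loc_of_deriv_le (a := 0) (b := 1)
    (μ := MeasureTheory.volume) (F := fun z v : ℝ => -(v * Real.sin (z * v)))
    (F' := fun z v : ℝ => -(v * v * Real.cos (z * v))) (x₀ := z) (s := Set.univ)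
    (bound := fun _ => 1) Filter.univ_mem
    (Eventually.of_forall fun x => by fun_prop)
    (Continuous.intervalIntegrable (by fun_prop) _ _) (by fun_prop)
    (Eventually.of_forall fun v hv x _ => ?_) (by simp)
    (Eventually.of_forall fun v hv x _ => ?_)).2
  · rw [Set.uIoc_of_le zero_le_one] at hv
    rw [norm_neg, norm_mul, Real.norm_eq_abs, Real.norm_eq_abs, abs_of_nonneg (mul_self_nonneg v)]
    exact mul_le_one₀ (by nlinarith [hv.1, hv.2]) (abs_nonneg _) (Real.abs_cos_le_one _)
  · refine ((((hasDerivAt_id x).mul_const v).sin).const_mul v).fun_neg.congr_deriv ?_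
    simp only [id_eq]
    ring

theorem abs_sincDeriv_le (z : ℝ) : |sincDeriv z| ≤ 1 := by
  have := intervalIntegral.norm_integral_le_of_norm_le_const (a := 0) (b := 1) (C := 1)
    (f := fun v : ℝ => -(v * Real.sin (z * v))) (fun v hv => by
      rw [Set.uIoc_of_le zero_le_one] at hv
      rw [norm_neg, norm_mul, Real.norm_eq_abs, Real.norm_eq_abs]
      exact mul_le_one₀ (by rw [abs_of_pos hv.1]; exact hv.2) (abs_nonneg _)
        (Real.abs_sin_le_one _))
  simpa [sincDeriv] using this

theorem abs_sincDeriv2_le (z : ℝ) : |sincDeriv2 z| ≤ 1 := by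
  have := intervalIntegral.norm_integral_le_of_norm_le_const (a := 0) (b := 1) (C := 1)
    (f := fun v : ℝ => -(v * v * Real.cos (z * v))) (fun v hv => by
      rw [Set.uIoc_of_le zero_le_one] at hv
      rw [norm_neg, norm_mul, Real.norm_eq_abs, Real.norm_eq_abs,
        abs_of_nonneg (mul_self_nonneg v)]
      exact mul_le_one₀ (by nlinarith [hv.1, hv.2]) (abs_nonneg _) (Real.abs_cos_le_one _))
  simpa [sincDeriv2] using this

theorem one_sub_abs_le_sinc (z : ℝ) : 1 - |z| ≤ Real.sinc z := by
  have := Convex.norm_image_sub_le_of_norm_hasDerivWithin_le (f := Real.sinc) (f' := sincDeriv)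
    (C := 1) (s := Set.univ) (x := 0) (y := z) (fun x _ => (hasDerivAt_sinc x).hasDerivWithinAt)
    (fun x _ => abs_sincDeriv_le x) convex_univ trivial trivial
  rw [Real.sinc_zero, sub_zero, one_mul, Real.norm_eq_abs, Real.norm_eq_abs] at this
  linarith [(abs_le.1 this).1]

theorem sinc_abs (z : ℝ) : Real.sinc |z| = Real.sinc z := by
  rcases abs_choice z with h | h <;> simp [h]

/-- On `[0, π]` the function `sinc` decreases by concavity of the sine, and beyond `π` it is bounded
by `1 / π`; so no point is exceeded by a point farther from the origin, as long as the former is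
close to the origin. -/
theorem abs_sinc_le_sinc {z z' : ℝ} (hz : |z| ≤ 1 / 2) (h : |z| ≤ |z'|) :
    |Real.sinc z'| ≤ Real.sinc z := by
  rw [← sinc_abs z, ← sinc_abs z']
  set a := |z| with ha
  set b := |z'| with hb
  have ha0 : 0 ≤ a := abs_nonneg z
  have hb0 : 0 ≤ b := abs_nonneg z'
  rcases eq_or_lt_of_le ha0 with h0 | h0
  · rw [← h0, Real.sinc_zero]
    exact Real.abs_sinc_le_one b
  have hbpos : 0 < b := h0.trans_le h
  rcases le_total b Real.pi with hbp | hbp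
  · have hs : 0 ≤ Real.sinc b := by
      rw [Real.sinc_of_ne_zero hbpos.ne']
      exact div_nonneg (Real.sin_nonneg_of_nonneg_of_le_pi hb0 hbp) hb0
    rw [abs_of_nonneg hs, Real.sinc_of_ne_zero hbpos.ne', Real.sinc_of_ne_zero h0.ne']
    have hconc := strictConcaveOn_sin_Icc.concaveOn.2
      (show (0 : ℝ) ∈ Set.Icc 0 Real.pi from ⟨le_refl _, Real.pi_pos.le⟩)
      (show b ∈ Set.Icc 0 Real.pi from ⟨hb0, hbp⟩)
      (show 0 ≤ 1 - a / b by rw [sub_nonneg, div_le_one hbpos]; exact h)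
      (show 0 ≤ a / b by positivity) (by ring)
    simp only [smul_eq_mul, Real.sin_zero, mul_zero, zero_add] at hconc
    rw [div_mul_cancel₀ _ hbpos.ne'] at hconc
    rw [le_div_iff₀ h0]
    calc Real.sin b / b * a = a / b * Real.sin b := by ring
      _ ≤ _ := hconc
  · have h1 := one_sub_abs_le_sinc a
    rw [abs_of_nonneg ha0] at h1
    have h2 : |Real.sinc b| ≤ 1 / 2 := by
      rw [Real.sinc_of_ne_zero hbpos.ne', abs_div, abs_of_pos hbpos, div_le_iff₀ hbpos]
      linarith [Real.abs_sin_le_one b, Real.pi_gt_three]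
    linarith

/-! ### Nonnegative cosine sums -/

/-- The `r`-th derivative of the cosine sum `∑ i ∈ s, w i * cos (θ i * u)`. -/
noncomputable def cosSum {ι : Type*} (s : Finset ι) (w θ : ι → ℝ) (r : ℕ) (u : ℝ) : ℝ :=
  ∑ i ∈ s, w i * θ i ^ r * Real.cos (θ i * u + r * (Real.pi / 2))

section CosSum

variable {ι : Type*} {s : Finset ι} {w θ : ι → ℝ}

theorem hasDerivAt_cosSum (s : Finset ι) (w θ : ι → ℝ) (r : ℕ) (u : ℝ) :
    HasDerivAt (cosSum s w θ r) (cosSum s w θ (r + 1) u) u := by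
  refine HasDerivAt.fun_sum fun i _ => ?_
  refine ((((hasDerivAt_id u).const_mul (θ i)).add_const
    ((r : ℝ) * (Real.pi / 2))).cos.const_mul (w i * θ i ^ r)).congr_deriv ?_
  have : θ i * u + ((r + 1 : ℕ) : ℝ) * (Real.pi / 2)
      = (θ i * u + r * (Real.pi / 2)) + Real.pi / 2 := by push_cast; ring
  rw [this, Real.cos_add_pi_div_two, id]
  ring

theorem cosSum_zero_eq (u : ℝ) : cosSum s w θ 0 u = ∑ i ∈ s, w i * Real.cos (θ i * u) := by
  simp [cosSum]

theorem cosSum_one_eq (u : ℝ) : cosSum s w θ 1 u = -∑ i ∈ s, w i * θ i * Real.sin (θ i * u) := by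
  simp [cosSum, Real.cos_add_pi_div_two]

theorem cosSum_two_eq (u : ℝ) :
    cosSum s w θ 2 u = -∑ i ∈ s, w i * θ i ^ 2 * Real.cos (θ i * u) := by
  have : (2 : ℝ) * (Real.pi / 2) = Real.pi := by ring
  simp [cosSum, this]

theorem cosSum_zero_apply_zero (hw1 : ∑ i ∈ s, w i = 1) : cosSum s w θ 0 0 = 1 := by
  simp [cosSum_zero_eq, hw1]

theorem cosSum_one_apply_zero : cosSum s w θ 1 0 = 0 := by
  simp [cosSum_one_eq]

theorem cosSum_two_apply_zero : cosSum s w θ 2 0 = -∑ i ∈ s, w i * θ i ^ 2 := by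
  simp [cosSum_two_eq]

theorem abs_cosSum_le (hw : ∀ i ∈ s, 0 ≤ w i) (r : ℕ) (u : ℝ) :
    |cosSum s w θ r u| ≤ ∑ i ∈ s, w i * |θ i| ^ r := by
  refine (Finset.abs_sum_le_sum_abs _ _).trans (Finset.sum_le_sum fun i hi => ?_)
  rw [abs_mul, abs_mul, abs_pow, abs_of_nonneg (hw i hi)]
  exact mul_le_of_le_one_right (mul_nonneg (hw i hi) (by positivity)) (Real.abs_cos_le_one _)

theorem abs_cosSum_two_le (hw : ∀ i ∈ s, 0 ≤ w i) (u : ℝ) :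
    |cosSum s w θ 2 u| ≤ ∑ i ∈ s, w i * θ i ^ 2 := by
  simpa using abs_cosSum_le (θ := θ) hw 2 u

theorem abs_cosSum_three_le (hw : ∀ i ∈ s, 0 ≤ w i) {Θ : ℝ} (hθ : ∀ i ∈ s, |θ i| ≤ Θ) (u : ℝ) :
    |cosSum s w θ 3 u| ≤ Θ * ∑ i ∈ s, w i * θ i ^ 2 := by
  refine (abs_cosSum_le hw 3 u).trans ?_
  rw [Finset.mul_sum]
  refine Finset.sum_le_sum fun i hi => ?_
  have h1 : 0 ≤ w i * θ i ^ 2 := mul_nonneg (hw i hi) (sq_nonneg _)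
  have h2 : w i * |θ i| ^ 3 = |θ i| * (w i * θ i ^ 2) := by
    rw [← sq_abs (θ i)]
    ring
  rw [h2]
  exact mul_le_mul_of_nonneg_right (hθ i hi) h1

/-- A bound of Bernstein type: by the inequality of arithmetic and geometric means
`|θ| ≤ θ ^ 2 / 4 + 1`. -/
theorem abs_cosSum_one_le (hw : ∀ i ∈ s, 0 ≤ w i) (hw1 : ∑ i ∈ s, w i = 1) (u : ℝ) :
    |cosSum s w θ 1 u| ≤ (∑ i ∈ s, w i * θ i ^ 2) / 4 + 1 := by
  refine (abs_cosSum_le hw 1 u).trans ?_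
  rw [← hw1, Finset.sum_div, ← Finset.sum_add_distrib]
  refine Finset.sum_le_sum fun i hi => ?_
  have h1 : |θ i| ≤ θ i ^ 2 / 4 + 1 := by
    rw [← sq_abs (θ i)]
    nlinarith [sq_nonneg (|θ i| - 2)]
  have := mul_le_mul_of_nonneg_left h1 (hw i hi)
  rw [pow_one]
  linarith

theorem abs_cosSum_one_le_mul_abs (hw : ∀ i ∈ s, 0 ≤ w i) (u : ℝ) :
    |cosSum s w θ 1 u| ≤ (∑ i ∈ s, w i * θ i ^ 2) * |u| := by
  rw [cosSum_one_eq, abs_neg, Finset.sum_mul]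
  refine (Finset.abs_sum_le_sum_abs _ _).trans (Finset.sum_le_sum fun i hi => ?_)
  rw [abs_mul, abs_mul, abs_of_nonneg (hw i hi)]
  have h1 : |Real.sin (θ i * u)| ≤ |θ i| * |u| := by
    rw [← abs_mul]
    exact Real.abs_sin_le_abs
  calc w i * |θ i| * |Real.sin (θ i * u)| ≤ w i * |θ i| * (|θ i| * |u|) :=
        mul_le_mul_of_nonneg_left h1 (mul_nonneg (hw i hi) (abs_nonneg _))
    _ = w i * θ i ^ 2 * |u| := by rw [← sq_abs (θ i)]; ring

/-- The constant is a lower bound for `cos (2 * π * 0.16749)`. -/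
theorem cosSum_two_le (hw : ∀ i ∈ s, 0 ≤ w i) (hθ : ∀ i ∈ s, |θ i| ≤ 2 * Real.pi) {u : ℝ}
    (hu : |u| ≤ 0.16749) : cosSum s w θ 2 u ≤ -(0.484 * ∑ i ∈ s, w i * θ i ^ 2) := by
  rw [cosSum_two_eq, neg_le_neg_iff, Finset.mul_sum]
  refine Finset.sum_le_sum fun i hi => ?_
  have h1 : |θ i * u / 2| ≤ 0.5262 := by
    rw [abs_div, abs_mul, abs_of_pos (two_pos : (0 : ℝ) < 2)]
    have h2 : |θ i| * |u| ≤ (2 * Real.pi) * 0.16749 :=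
      mul_le_mul (hθ i hi) hu (abs_nonneg _) (by positivity)
    linarith [Real.pi_lt_d4]
  have h3 : (θ i * u / 2) ^ 2 ≤ 0.5262 ^ 2 := sq_le_sq' (abs_le.1 h1).1 (abs_le.1 h1).2
  have h4 := Real.one_sub_sq_div_two_le_cos (x := θ i * u / 2)
  have h5 := Real.cos_two_mul (θ i * u / 2)
  rw [show 2 * (θ i * u / 2) = θ i * u by ring] at h5
  have h6 : (0.861556 : ℝ) ≤ Real.cos (θ i * u / 2) := by norm_num at h3; linarith
  have h7 : 0.484 ≤ Real.cos (θ i * u) := by rw [h5]; nlinarith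
  have := mul_le_mul_of_nonneg_left h7 (mul_nonneg (hw i hi) (sq_nonneg (θ i)))
  linarith

theorem one_sub_cos_ge {y : ℝ} (hy : |y| ≤ 4) :
    (1 - y ^ 2 / 24) ^ 2 * y ^ 2 / 2 ≤ 1 - Real.cos y := by
  rw [← Real.cos_abs y, ← sq_abs y]
  set a := |y|
  have ha : 0 ≤ a := abs_nonneg y
  have h1 := Real.sin_ge_sub_cube (x := a / 2) (by positivity)
  have h2 : Real.cos a = 1 - 2 * Real.sin (a / 2) ^ 2 := by
    have h5 := Real.cos_two_mul (a / 2)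
    rw [Real.cos_sq', show 2 * (a / 2) = a by ring] at h5
    linarith
  have h3 : 0 ≤ a / 2 - (a / 2) ^ 3 / 6 := by
    have : a / 2 - (a / 2) ^ 3 / 6 = a / 2 * (1 - a ^ 2 / 24) := by ring
    rw [this]
    exact mul_nonneg (by positivity) (by nlinarith)
  have h4 := pow_le_pow_left₀ h3 h1 2
  rw [h2]
  nlinarith

theorem cosSum_zero_le_one_sub (hw : ∀ i ∈ s, 0 ≤ w i) (hw1 : ∑ i ∈ s, w i = 1) {Θ : ℝ}
    (hθ : ∀ i ∈ s, |θ i| ≤ Θ) {u : ℝ} (hu : Θ * |u| ≤ 4) :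
    cosSum s w θ 0 u ≤ 1 - (1 - (Θ * u) ^ 2 / 24) ^ 2 * (∑ i ∈ s, w i * θ i ^ 2) * u ^ 2 / 2 := by
  rw [cosSum_zero_eq]
  have key : ∑ i ∈ s, (1 - (Θ * u) ^ 2 / 24) ^ 2 * (w i * θ i ^ 2) * u ^ 2 / 2
      ≤ ∑ i ∈ s, (w i - w i * Real.cos (θ i * u)) := by
    refine Finset.sum_le_sum fun i hi => ?_
    have h0 : |θ i * u| ≤ Θ * |u| := by
      rw [abs_mul]
      exact mul_le_mul_of_nonneg_right (hθ i hi) (abs_nonneg u)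
    have h1 : (θ i * u) ^ 2 ≤ (Θ * u) ^ 2 := by
      rw [← sq_abs (θ i * u), mul_pow Θ u, ← sq_abs u, ← mul_pow]
      exact pow_le_pow_left₀ (abs_nonneg _) h0 2
    have h4 : (Θ * u) ^ 2 ≤ 4 ^ 2 := by
      rw [mul_pow Θ u, ← sq_abs u, ← mul_pow]
      exact pow_le_pow_left₀ ((abs_nonneg _).trans h0) hu 2
    have h2 := one_sub_cos_ge (h0.trans hu)
    have h3 : (1 - (Θ * u) ^ 2 / 24) ^ 2 ≤ (1 - (θ i * u) ^ 2 / 24) ^ 2 :=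
      pow_le_pow_left₀ (by linarith) (by linarith) 2
    have h5 := mul_le_mul_of_nonneg_right h3 (sq_nonneg (θ i * u))
    have h6 := mul_le_mul_of_nonneg_left (show (1 - (Θ * u) ^ 2 / 24) ^ 2 * (θ i * u) ^ 2 / 2
      ≤ 1 - Real.cos (θ i * u) by linarith) (hw i hi)
    calc _ = w i * ((1 - (Θ * u) ^ 2 / 24) ^ 2 * (θ i * u) ^ 2 / 2) := by ring
      _ ≤ _ := h6
      _ = _ := by ring
  rw [Finset.sum_sub_distrib, hw1, ← Finset.sum_div, ← Finset.sum_mul, ← Finset.mul_sum] at key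
  linarith

/-- Each `cos (θ * u)` is bounded by `cos (θ * u₀)` as long as `θ * |u|` lies between `θ * |u₀|` and
`2 * π - θ * |u₀|`. -/
theorem cosSum_zero_le_cosSum_zero (hw : ∀ i ∈ s, 0 ≤ w i) {Θ : ℝ} (hθ : ∀ i ∈ s, |θ i| ≤ Θ)
    {u u₀ : ℝ} (hu : |u₀| ≤ |u|) (hΘ : Θ * (|u| + |u₀|) ≤ 2 * Real.pi) :
    cosSum s w θ 0 u ≤ cosSum s w θ 0 u₀ := by
  rw [cosSum_zero_eq, cosSum_zero_eq]
  refine Finset.sum_le_sum fun i hi => mul_le_mul_of_nonneg_left ?_ (hw i hi)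
  rw [← Real.cos_abs (θ i * u), ← Real.cos_abs (θ i * u₀), abs_mul, abs_mul]
  set t := |θ i|
  have ht : 0 ≤ t := abs_nonneg _
  have h1 : t * |u₀| ≤ t * |u| := mul_le_mul_of_nonneg_left hu ht
  have h0 : 0 ≤ t * |u₀| := by positivity
  have h2 : t * |u| + t * |u₀| ≤ 2 * Real.pi := by
    rw [← mul_add]
    exact (mul_le_mul_of_nonneg_right (hθ i hi) (by positivity)).trans hΘ
  rcases le_total (t * |u|) Real.pi with h3 | h3
  · exact Real.cos_le_cos_of_nonneg_of_le_pi h0 h3 h1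
  · rw [← Real.cos_two_pi_sub (t * |u|)]
    exact Real.cos_le_cos_of_nonneg_of_le_pi h0 (by linarith) (by linarith)

end CosSum

/-- `f` is a cosine polynomial `x ↦ ∑ k ≤ n, w k * cos (2 * π * k * x)` with nonnegative
coefficients. -/
def IsPosCosPoly (n : ℕ) (f : ℝ → ℝ) : Prop :=
  ∃ w : ℕ → ℝ, (∀ k, 0 ≤ w k) ∧
    ∀ x, f x = ∑ k ∈ Finset.range (n + 1), w k * Real.cos (2 * Real.pi * k * x)

namespace IsPosCosPoly

theorem cos {n : ℕ} (j : ℤ) (hj : |j| ≤ n) :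
    IsPosCosPoly n fun x => Real.cos (2 * Real.pi * j * x) := by
  refine ⟨fun k => if k = j.natAbs then 1 else 0, fun k => by
    beta_reduce
    split_ifs <;> norm_num, fun x => ?_⟩
  rw [Finset.sum_eq_single_of_mem j.natAbs 
    (Finset.mem_range.2 (by rw [Int.abs_eq_natAbs] at hj; omega)) (fun k _ hk => by simp [hk])]
  have : ((j.natAbs : ℕ) : ℝ) = |(j : ℝ)| := by rw [Nat.cast_natAbs]; simp
  simp only [if_true, one_mul, this]
  rcases abs_choice (j : ℝ) with h | h
  · rw [h]
  · rw [h, ← Real.cos_neg]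
    ring_nf

theorem sum {n : ℕ} {ι : Type*} (s : Finset ι) {f : ι → ℝ → ℝ}
    (hf : ∀ i ∈ s, IsPosCosPoly n (f i)) : IsPosCosPoly n fun x => ∑ i ∈ s, f i x := by
  classical
  choose! w hw using hf
  refine ⟨fun k => ∑ i ∈ s, w i k, fun k => Finset.sum_nonneg fun i hi => (hw i hi).1 k,
    fun x => ?_⟩
  beta_reduce
  rw [Finset.sum_congr rfl fun i hi => (hw i hi).2 x, Finset.sum_comm]
  simp only [Finset.sum_mul]

theorem const_mul {n : ℕ} {f : ℝ → ℝ} (hf : IsPosCosPoly n f) {c : ℝ} (hc : 0 ≤ c) :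
    IsPosCosPoly n fun x => c * f x := by
  obtain ⟨w, hw, h⟩ := hf
  exact ⟨fun k => c * w k, fun k => mul_nonneg hc (hw k), fun x => by
    beta_reduce
    rw [h, Finset.mul_sum]
    exact Finset.sum_congr rfl fun _ _ => by ring⟩

theorem add {n : ℕ} {f g : ℝ → ℝ} (hf : IsPosCosPoly n f) (hg : IsPosCosPoly n g) :
    IsPosCosPoly n fun x => f x + g x := by
  obtain ⟨w, hw, h⟩ := hf
  obtain ⟨w', hw', h'⟩ := hg
  exact ⟨fun k => w k + w' k, fun k => add_nonneg (hw k) (hw' k), fun x => by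
    beta_reduce
    rw [h, h', ← Finset.sum_add_distrib]
    exact Finset.sum_congr rfl fun _ _ => by ring⟩

theorem mul {n n' : ℕ} {f g : ℝ → ℝ} (hf : IsPosCosPoly n f) (hg : IsPosCosPoly n' g) :
    IsPosCosPoly (n + n') fun x => f x * g x := by
  obtain ⟨w, hw, h⟩ := hf
  obtain ⟨w', hw', h'⟩ := hg
  have key : (fun x => f x * g x) = fun x => ∑ k ∈ Finset.range (n + 1),
      ∑ l ∈ Finset.range (n' + 1), w k * w' l / 2 *
        (Real.cos (2 * Real.pi * ((k + l : ℤ) : ℝ) * x)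
          + Real.cos (2 * Real.pi * ((k - l : ℤ) : ℝ) * x)) := by
    funext x
    rw [h, h', Finset.sum_mul_sum]
    refine Finset.sum_congr rfl fun k _ => Finset.sum_congr rfl fun l _ => ?_
    push_cast
    rw [show 2 * Real.pi * (k + l : ℝ) * x = 2 * Real.pi * k * x + 2 * Real.pi * l * x by ring,
      show 2 * Real.pi * (k - l : ℝ) * x = 2 * Real.pi * k * x - 2 * Real.pi * l * x by ring,
      Real.cos_add, Real.cos_sub]
    ring
  rw [key]
  refine sum _ fun k hk => sum _ fun l hl => const_mul (add (cos _ ?_) (cos _ ?_))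
    (by have := hw k; have := hw' l; positivity)
  all_goals
    rw [Finset.mem_range] at hk hl
    rw [abs_le]
    push_cast
    constructor <;> omega

theorem mono {n n' : ℕ} {f : ℝ → ℝ} (hf : IsPosCosPoly n f) (h : n ≤ n') : IsPosCosPoly n' f := by
  obtain ⟨w, hw, hf⟩ := hf
  have : f = fun x => ∑ k ∈ Finset.range (n + 1),
      w k * Real.cos (2 * Real.pi * ((k : ℤ) : ℝ) * x) := funext fun x => by simpa using hf x
  rw [this]
  refine sum _ fun k hk => const_mul (cos _ ?_) (hw k)
  rw [Finset.mem_range] at hk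
  rw [abs_le]
  constructor <;> omega

end IsPosCosPoly

/-! ### Trigonometric polynomials -/

namespace IsTrigPoly

theorem exp {m : ℕ} (j : ℤ) (hj : |j| ≤ m) :
    IsTrigPoly m fun x => Complex.exp (2 * Real.pi * Complex.I * j * x) := by
  refine ⟨fun k => if k = j then 1 else 0, fun x => ?_⟩
  rw [Finset.sum_eq_single_of_mem j (Finset.mem_Icc.2 (abs_le.1 hj)) (fun k _ hk => by simp [hk])]
  simp

theorem const_mul {m : ℕ} {q : ℝ → ℂ} (hq : IsTrigPoly m q) (c : ℂ) :
    IsTrigPoly m fun x => c * q x := by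
  obtain ⟨a, h⟩ := hq
  exact ⟨fun k => c * a k, fun x => by
    beta_reduce
    rw [h, Finset.mul_sum]
    exact Finset.sum_congr rfl fun _ _ => by ring⟩

theorem add {m : ℕ} {q q' : ℝ → ℂ} (hq : IsTrigPoly m q) (hq' : IsTrigPoly m q') :
    IsTrigPoly m fun x => q x + q' x := by
  obtain ⟨a, h⟩ := hq
  obtain ⟨a', h'⟩ := hq'
  exact ⟨fun k => a k + a' k, fun x => by
    beta_reduce
    rw [h, h', ← Finset.sum_add_distrib]
    exact Finset.sum_congr rfl fun _ _ => by ring⟩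

theorem sum {m : ℕ} {ι : Type*} (s : Finset ι) {f : ι → ℝ → ℂ}
    (hf : ∀ i ∈ s, IsTrigPoly m (f i)) : IsTrigPoly m fun x => ∑ i ∈ s, f i x := by
  classical
  choose! w hw using hf
  refine ⟨fun k => ∑ i ∈ s, w i k, fun x => ?_⟩
  beta_reduce
  rw [Finset.sum_congr rfl fun i hi => hw i hi x, Finset.sum_comm]
  simp only [Finset.sum_mul]

theorem cos_add {m : ℕ} (j : ℤ) (hj : |j| ≤ m) (φ : ℝ) :
    IsTrigPoly m fun x => (Real.cos (2 * Real.pi * j * x + φ) : ℂ) := by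
  have h := ((exp j hj).const_mul (Complex.exp (φ * Complex.I) / 2)).add
    ((exp (-j) (by rwa [abs_neg])).const_mul (Complex.exp (-(φ * Complex.I)) / 2))
  convert h using 2 with x
  rw [Complex.ofReal_cos, Complex.cos, div_mul_eq_mul_div, div_mul_eq_mul_div, ← Complex.exp_add,
    ← Complex.exp_add, ← add_div]
  push_cast
  ring_nf

theorem apply_add_intCast {m : ℕ} {q : ℝ → ℂ} (hq : IsTrigPoly m q) (x : ℝ) (n : ℤ) :
    q (x + n) = q x := by
  obtain ⟨a, h⟩ := hq
  rw [h, h]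
  refine Finset.sum_congr rfl fun k _ => ?_
  congr 1
  have : (2 * Real.pi * Complex.I * k * ((x + n : ℝ) : ℂ) : ℂ)
      = 2 * Real.pi * Complex.I * k * x + ((k * n : ℤ) : ℂ) * (2 * Real.pi * Complex.I) := by
    push_cast
    ring
  rw [this, Complex.exp_add, Complex.exp_int_mul_two_pi_mul_I, mul_one]

theorem cosSum_sub {m n : ℕ} (hm : 0 < m) (hn : n ≤ m) (w : ℕ → ℝ) (r : ℕ) (t : ℝ) :
    IsTrigPoly m fun x => (cosSum (Finset.range (n + 1)) w
      (fun k => 2 * Real.pi * k / m) r (m * (x - t)) : ℂ) := by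
  simp only [cosSum, Complex.ofReal_sum, Complex.ofReal_mul]
  refine sum _ fun k hk => const_mul ?_ _
  rw [Finset.mem_range] at hk
  convert cos_add (m := m) (k : ℤ) (by rw [Nat.abs_cast]; omega)
    (-(2 * Real.pi * k * t) + r * (Real.pi / 2)) using 4 with x
  push_cast
  field_simp
  ring

end IsTrigPoly

/-! ### The Dirichlet kernel and its fourth power -/

/-- The frequencies, in the variable `u = m * x`, of the Dirichlet kernel with `N` terms; they are
symmetric about zero, and half-integral multiples of `2 * π / m` for even `N`. -/
noncomputable def dirichletFreq (m N k : ℕ) : ℝ := Real.pi / m * (2 * k - N + 1)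

/-- The `r`-th derivative of the Dirichlet kernel `sin (N * h * u) / (N * sin (h * u))`, where
`h = π / m`, normalized to have the value `1` at `0`. -/
noncomputable def dirichletKernel (m N r : ℕ) (u : ℝ) : ℝ :=
  cosSum (Finset.range N) (fun _ => 1 / (N : ℝ)) (dirichletFreq m N) r u

section Dirichlet

variable {m N : ℕ}

theorem hasDerivAt_dirichletKernel (m N r : ℕ) (u : ℝ) :
    HasDerivAt (dirichletKernel m N r) (dirichletKernel m N (r + 1) u) u :=
  hasDerivAt_cosSum _ _ _ r u

theorem sin_mul_dirichletKernel_zero (u : ℝ) :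
    Real.sin (Real.pi / m * u) * dirichletKernel m N 0 u
      = Real.sin (N * (Real.pi / m) * u) / N := by
  rw [dirichletKernel, cosSum_zero_eq, Finset.mul_sum]
  have key : ∀ k ∈ Finset.range N,
      Real.sin (Real.pi / m * u) * (1 / (N : ℝ) * Real.cos (dirichletFreq m N k * u))
      = Real.sin (Real.pi / m * (2 * ((k + 1 : ℕ) : ℝ) - N) * u) / (2 * N)
        - Real.sin (Real.pi / m * (2 * (k : ℝ) - N) * u) / (2 * N) := fun k _ => by
    have e1 : Real.pi / m * (2 * ((k + 1 : ℕ) : ℝ) - N) * u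
        = dirichletFreq m N k * u + Real.pi / m * u := by
      rw [dirichletFreq]; push_cast; ring
    have e2 : Real.pi / m * (2 * (k : ℝ) - N) * u
        = dirichletFreq m N k * u - Real.pi / m * u := by
      rw [dirichletFreq]; ring
    rw [e1, e2, Real.sin_add, Real.sin_sub]
    ring
  rw [Finset.sum_congr rfl key, Finset.sum_range_sub
    (fun k : ℕ => Real.sin (Real.pi / m * (2 * (k : ℝ) - N) * u) / (2 * N))]
  have e3 : Real.pi / m * (2 * ((0 : ℕ) : ℝ) - N) * u = -(N * (Real.pi / m) * u) := by
    push_cast; ring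
  have e4 : Real.pi / m * (2 * (N : ℝ) - N) * u = N * (Real.pi / m) * u := by ring
  rw [e3, e4, Real.sin_neg]
  ring

theorem sin_mul_dirichletKernel_one (hN : 0 < N) (u : ℝ) :
    Real.sin (Real.pi / m * u) * dirichletKernel m N 1 u
      + Real.pi / m * Real.cos (Real.pi / m * u) * dirichletKernel m N 0 u
      = Real.pi / m * Real.cos (N * (Real.pi / m) * u) := by
  have hN' : (N : ℝ) ≠ 0 := by positivity
  have h1 := (((hasDerivAt_id u).const_mul (Real.pi / m)).sin).fun_mul
    (hasDerivAt_dirichletKernel m N 0 u)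
  have h2 := (((hasDerivAt_id u).const_mul (N * (Real.pi / m))).sin).div_const (N : ℝ)
  simp only [id_eq] at h1 h2
  have h3 := h1.unique (h2.congr_of_eventuallyEq
    (Filter.Eventually.of_forall fun v => sin_mul_dirichletKernel_zero v))
  field_simp at h3 ⊢
  linarith

theorem sin_mul_dirichletKernel_two (hN : 0 < N) (u : ℝ) :
    Real.sin (Real.pi / m * u) * dirichletKernel m N 2 u
      + 2 * (Real.pi / m) * Real.cos (Real.pi / m * u) * dirichletKernel m N 1 u
      - (Real.pi / m) ^ 2 * Real.sin (Real.pi / m * u) * dirichletKernel m N 0 u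
      = -((Real.pi / m) ^ 2 * N * Real.sin (N * (Real.pi / m) * u)) := by
  have h1 := ((((hasDerivAt_id u).const_mul (Real.pi / m)).sin).fun_mul
    (hasDerivAt_dirichletKernel m N 1 u)).fun_add
    (((((hasDerivAt_id u).const_mul (Real.pi / m)).cos).const_mul (Real.pi / m)).fun_mul
    (hasDerivAt_dirichletKernel m N 0 u))
  have h2 := (((hasDerivAt_id u).const_mul (N * (Real.pi / m))).cos).const_mul (Real.pi / m)
  simp only [id_eq] at h1 h2
  have h3 := h1.unique (h2.congr_of_eventuallyEq
    (Filter.Eventually.of_forall fun v => sin_mul_dirichletKernel_one hN v))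
  linear_combination h3

theorem sin_mul_dirichletKernel_three (hN : 0 < N) (u : ℝ) :
    Real.sin (Real.pi / m * u) * dirichletKernel m N 3 u
      + 3 * (Real.pi / m) * Real.cos (Real.pi / m * u) * dirichletKernel m N 2 u
      - 3 * (Real.pi / m) ^ 2 * Real.sin (Real.pi / m * u) * dirichletKernel m N 1 u
      - (Real.pi / m) ^ 3 * Real.cos (Real.pi / m * u) * dirichletKernel m N 0 u
      = -((Real.pi / m) ^ 3 * N ^ 2 * Real.cos (N * (Real.pi / m) * u)) := by
  have h1 := (((((hasDerivAt_id u).const_mul (Real.pi / m)).sin).fun_mul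
    (hasDerivAt_dirichletKernel m N 2 u)).fun_add
    (((((hasDerivAt_id u).const_mul (Real.pi / m)).cos).const_mul (2 * (Real.pi / m))).fun_mul
    (hasDerivAt_dirichletKernel m N 1 u))).fun_sub
    (((((hasDerivAt_id u).const_mul (Real.pi / m)).sin).const_mul ((Real.pi / m) ^ 2)).fun_mul
    (hasDerivAt_dirichletKernel m N 0 u))
  have h2 := ((((hasDerivAt_id u).const_mul (N * (Real.pi / m))).sin).const_mul
    ((Real.pi / m) ^ 2 * N)).fun_neg
  simp only [id_eq] at h1 h2
  have h3 := h1.unique (h2.congr_of_eventuallyEq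
    (Filter.Eventually.of_forall fun v => sin_mul_dirichletKernel_two hN v))
  linear_combination h3

/-- The decay of the Dirichlet kernel and of its derivatives, in terms of `τ = m * |sin (h * u)| / 2`
with `h = π / m`. Differentiating `sin (h * u) * D u = sin (N * h * u) / N` expresses each
derivative by the lower ones. -/
theorem abs_dirichletKernel_le (hm : 10 ≤ m) (hN1 : m ≤ 2 * N) (hN2 : (N : ℝ) ≤ 0.6 * m) (u : ℝ)
    {τ : ℝ} (hτ : τ = m * |Real.sin (Real.pi / m * u)| / 2) :
    τ * |dirichletKernel m N 0 u| ≤ 1 ∧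
    (2.5 ≤ τ → τ * |dirichletKernel m N 1 u| ≤ 2.2) ∧
    (4.83 ≤ τ → τ * |dirichletKernel m N 1 u| ≤ 1.9 ∧ τ * |dirichletKernel m N 2 u| ≤ 4.31 ∧
      τ * |dirichletKernel m N 3 u| ≤ 10.45) := by
  have hN : 0 < N := by omega
  have hNr : (0 : ℝ) < N := by exact_mod_cast hN
  have hmr : (10 : ℝ) ≤ m := by exact_mod_cast hm
  have hN1r : (m : ℝ) ≤ 2 * N := by exact_mod_cast hN1
  set h := Real.pi / m with hh
  have hmh : m * h = Real.pi := by rw [hh]; field_simp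
  have hpi0 := Real.pi_gt_d4
  have hpi1 := Real.pi_lt_d4
  have h0 : 0 < h := by rw [hh]; positivity
  have hle : h ≤ 0.31416 := by rw [hh, div_le_iff₀ (by linarith)]; nlinarith
  have hNh : N * h ≤ 1.88496 := by nlinarith
  set S := Real.sin (h * u) with hS
  set c := Real.cos (h * u) with hc
  have hc1 : |c| ≤ 1 := Real.abs_cos_le_one _
  have hS1 : |S| ≤ 1 := Real.abs_sin_le_one _
  have hS0 := abs_nonneg S
  set D0 := dirichletKernel m N 0 u with hD0
  set D1 := dirichletKernel m N 1 u with hD1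
  set D2 := dirichletKernel m N 2 u with hD2
  set D3 := dirichletKernel m N 3 u with hD3
  have e0 : S * D0 = _ := sin_mul_dirichletKernel_zero u
  have e1 : S * D1 + h * c * D0 = _ := sin_mul_dirichletKernel_one hN u
  have e2 : S * D2 + 2 * h * c * D1 - h ^ 2 * S * D0 = _ := sin_mul_dirichletKernel_two hN u
  have e3 : S * D3 + 3 * h * c * D2 - 3 * h ^ 2 * S * D1 - h ^ 3 * c * D0 = _ :=
    sin_mul_dirichletKernel_three hN u
  rw [← hh] at e0 e1 e2 e3
  set s' := Real.sin (N * h * u)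
  set c' := Real.cos (N * h * u)
  have hs' : |s'| ≤ 1 := Real.abs_sin_le_one _
  have hc' : |c'| ≤ 1 := Real.abs_cos_le_one _
  have a0 := abs_nonneg D0
  have a1 := abs_nonneg D1
  have a2 := abs_nonneg D2
  have cm : ∀ x : ℝ, |c * x| ≤ |x| := fun x => by
    rw [abs_mul]; exact mul_le_of_le_one_left (abs_nonneg x) hc1
  have b0 : |S| * |D0| ≤ 1 / N := by
    rw [← abs_mul, e0, abs_div, abs_of_pos hNr]
    exact div_le_div_of_nonneg_right hs' hNr.le
  have b1 : |S| * |D1| ≤ h * (1 + |D0|) := by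
    rw [← abs_mul, show S * D1 = h * (c' + -(c * D0)) by linear_combination e1, abs_mul,
      abs_of_pos h0]
    refine mul_le_mul_of_nonneg_left ((abs_add_le _ _).trans ?_) h0.le
    rw [abs_neg]
    exact add_le_add hc' (cm _)
  have b2 : |S| * |D2| ≤ h * (h * N + 2 * |D1| + h * (|S| * |D0|)) := by
    rw [← abs_mul, ← abs_mul S D0,
      show S * D2 = h * (-(h * N * s') + -(2 * (c * D1)) + h * (S * D0)) by
        linear_combination e2, abs_mul, abs_of_pos h0]
    refine mul_le_mul_of_nonneg_left ((abs_add_three _ _ _).trans ?_) h0.le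
    rw [abs_neg, abs_neg, abs_mul (h * N), abs_mul 2, abs_mul h (S * D0), abs_of_pos h0,
      abs_of_pos (by positivity : 0 < h * N), abs_of_pos (two_pos : (0 : ℝ) < 2)]
    have := mul_le_mul_of_nonneg_left hs' (by positivity : 0 ≤ h * N)
    linarith [cm D1]
  have b3 : |S| * |D3| ≤ h * ((h * N) ^ 2 + 3 * |D2| + h ^ 2 * |D0| + 3 * h * (|S| * |D1|)) := by
    rw [← abs_mul, ← abs_mul S D1,
      show S * D3 = h * ((-((h * N) ^ 2 * c') + -(3 * (c * D2)) + h ^ 2 * (c * D0))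
        + 3 * h * (S * D1)) by linear_combination e3, abs_mul, abs_of_pos h0]
    refine mul_le_mul_of_nonneg_left ((abs_add_le _ _).trans
      (add_le_add ((abs_add_three _ _ _).trans ?_) ?_)) h0.le
    · rw [abs_neg, abs_neg, abs_mul ((h * N) ^ 2), abs_mul 3, abs_mul (h ^ 2) (c * D0),
        abs_of_pos (by positivity : 0 < h ^ 2), abs_of_pos (by positivity : 0 < (h * N) ^ 2),
        abs_of_pos (three_pos : (0 : ℝ) < 3)]
      have := mul_le_mul_of_nonneg_left hc' (by positivity : 0 ≤ (h * N) ^ 2)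
      have := mul_le_mul_of_nonneg_left (cm D0) (by positivity : 0 ≤ h ^ 2)
      linarith [cm D2]
    · rw [abs_mul, abs_of_pos (by positivity : 0 < 3 * h)]
  have hτS : ∀ x : ℝ, τ * x = m / 2 * (|S| * x) := fun x => by rw [hτ]; ring
  have g0 : τ * |D0| ≤ 1 := by
    rw [hτS]
    calc (m : ℝ) / 2 * (|S| * |D0|) ≤ m / 2 * (1 / N) :=
          mul_le_mul_of_nonneg_left b0 (by positivity)
      _ ≤ 1 := by
          rw [mul_one_div, div_div, div_le_one (by positivity)]
          exact hN1r
  have scale : ∀ x y : ℝ, |S| * x ≤ h * y → τ * x ≤ Real.pi / 2 * y := fun x y hxy => by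
    rw [hτS]
    calc (m : ℝ) / 2 * (|S| * x) ≤ m / 2 * (h * y) := mul_le_mul_of_nonneg_left hxy (by positivity)
      _ = Real.pi / 2 * y := by rw [← hmh]; ring
  have g1 := scale _ _ b1
  have g2 := scale _ _ b2
  have g3 := scale _ _ b3
  have hSτ : h * |S| = 2 * h ^ 2 * τ / Real.pi := by
    rw [hτ, ← hmh]; field_simp
  have h2 : h ^ 2 ≤ 0.0987 := by
    calc h ^ 2 ≤ 0.31416 ^ 2 := pow_le_pow_left₀ h0.le hle 2
      _ ≤ _ := by norm_num
  have hSle : ∀ x a : ℝ, 0 ≤ a → τ * x ≤ a → h * (|S| * x) ≤ 0.06284 * a := fun x a ha hx => by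
    have e : h * (|S| * x) = 2 * h ^ 2 / Real.pi * (τ * x) := by
      rw [← mul_assoc, hSτ]; ring
    rw [e]
    have h5 : 2 * h ^ 2 / Real.pi ≤ 0.06284 := by
      rw [div_le_iff₀ Real.pi_pos]; linarith
    exact (mul_le_mul_of_nonneg_left hx (by positivity)).trans (mul_le_mul_of_nonneg_right h5 ha)
  have quot : ∀ {t x a : ℝ}, 0 < t → t ≤ τ → 0 ≤ x → τ * x ≤ a → x ≤ a / t :=
    fun ht htτ hx hxa => (le_div_iff₀' ht).2 ((mul_le_mul_of_nonneg_right htτ hx).trans hxa)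
  have hpi : ∀ {y b : ℝ}, 0 ≤ b → y ≤ b → Real.pi / 2 * y ≤ 1.5708 * b := fun hb hy =>
    (mul_le_mul_of_nonneg_left hy (by positivity)).trans
      (mul_le_mul_of_nonneg_right (by linarith) hb)
  refine ⟨g0, fun ht => ?_, fun ht => ?_⟩
  · have i0 := quot (by norm_num) ht a0 g0
    have := hpi (b := 1.4) (by norm_num) (by norm_num at i0 ⊢; linarith) |>.trans' g1
    norm_num at this ⊢
    linarith
  · have i0 : |D0| ≤ 0.20705 := (quot (by norm_num) ht a0 g0).trans (by norm_num)
    have i1 : τ * |D1| ≤ 1.9 :=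
      (g1.trans (hpi (b := 1.20705) (by norm_num) (by linarith))).trans (by norm_num)
    have i1' : |D1| ≤ 0.3934 := (quot (by norm_num) ht a1 i1).trans (by norm_num)
    have i2 : τ * |D2| ≤ 4.31 :=
      (g2.trans (hpi (b := 2.7346) (by norm_num)
        (by linarith [hSle _ _ zero_le_one g0]))).trans (by norm_num)
    have i2' : |D2| ≤ 0.8924 := (quot (by norm_num) ht a2 i2).trans (by norm_num)
    have h3 : (h * N) ^ 2 ≤ 3.5531 := by
      calc (h * N) ^ 2 ≤ 1.88496 ^ 2 := pow_le_pow_left₀ (by positivity) (by linarith) 2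
        _ ≤ _ := by norm_num
    have h4 : h ^ 2 * |D0| ≤ 0.0987 * 0.20705 := mul_le_mul h2 i0 a0 (by norm_num)
    have h5 := hSle _ _ (by norm_num) i1
    exact ⟨i1, i2, (g3.trans (hpi (b := 6.6108) (by norm_num)
      (by norm_num at h5 h4; linarith))).trans (by norm_num)⟩

/-- Sums and differences of the possibly half-integral frequencies of the Dirichlet kernel are
integral, so its square is a cosine polynomial for either parity of `N`. -/
theorem isPosCosPoly_dirichletKernel_sq (hm : 0 < m) (hN : 0 < N) :
    IsPosCosPoly (N - 1) fun x => dirichletKernel m N 0 (m * x) ^ 2 := by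
  have hmr : (m : ℝ) ≠ 0 := by positivity
  have key : (fun x => dirichletKernel m N 0 (m * x) ^ 2) = fun x =>
      ∑ k ∈ Finset.range N, ∑ l ∈ Finset.range N, 1 / (N : ℝ) ^ 2 / 2 *
        (Real.cos (2 * Real.pi * ((k + l - N + 1 : ℤ) : ℝ) * x)
          + Real.cos (2 * Real.pi * ((k - l : ℤ) : ℝ) * x)) := by
    funext x
    rw [dirichletKernel, cosSum_zero_eq, sq, Finset.sum_mul_sum]
    refine Finset.sum_congr rfl fun k _ => Finset.sum_congr rfl fun l _ => ?_
    have e1 : 2 * Real.pi * ((k + l - N + 1 : ℤ) : ℝ) * x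
        = dirichletFreq m N k * (m * x) + dirichletFreq m N l * (m * x) := by
      rw [dirichletFreq, dirichletFreq]; push_cast; field_simp; ring
    have e2 : 2 * Real.pi * ((k - l : ℤ) : ℝ) * x
        = dirichletFreq m N k * (m * x) - dirichletFreq m N l * (m * x) := by
      rw [dirichletFreq, dirichletFreq]; push_cast; field_simp; ring
    rw [e1, e2, Real.cos_add, Real.cos_sub]
    ring
  rw [key]
  refine .sum _ fun k hk => .sum _ fun l hl => .const_mul (.add (.cos _ ?_) (.cos _ ?_))
    (by positivity)
  all_goals
    rw [Finset.mem_range] at hk hl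
    rw [abs_le]
    constructor <;> omega

theorem sum_sq_symmetric (N : ℕ) :
    ∑ k ∈ Finset.range N, (2 * (k : ℝ) - N + 1) ^ 2 = N * ((N : ℝ) ^ 2 - 1) / 3 := by
  have key : ∀ (n : ℕ) (c : ℝ), ∑ k ∈ Finset.range n, (2 * (k : ℝ) - c) ^ 2
      = 2 * n * (n - 1) * (2 * n - 1) / 3 - 2 * c * n * (n - 1) + n * c ^ 2 := by
    intro n c
    induction n with
    | zero => simp
    | succ n ih => rw [Finset.sum_range_succ, ih]; push_cast; ring
  have := key N (N - 1)
  simp only [sub_sub_eq_add_sub, sub_add_eq_add_sub] at this ⊢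
  rw [Finset.sum_congr rfl (g := fun k : ℕ => (2 * (k : ℝ) + 1 - N) ^ 2) (fun k _ => by ring), this]
  ring

theorem dirichletKernel_zero_apply_zero (hN : 0 < N) : dirichletKernel m N 0 0 = 1 :=
  cosSum_zero_apply_zero (by simp [hN.ne'])

theorem dirichletKernel_two_apply_zero (hN : 0 < N) :
    dirichletKernel m N 2 0 = -((Real.pi / m) ^ 2 * ((N : ℝ) ^ 2 - 1) / 3) := by
  have hN' : (N : ℝ) ≠ 0 := by positivity
  rw [dirichletKernel, cosSum_two_apply_zero, neg_inj]
  have : ∀ k ∈ Finset.range N, 1 / (N : ℝ) * dirichletFreq m N k ^ 2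
      = 1 / (N : ℝ) * (Real.pi / m) ^ 2 * (2 * (k : ℝ) - N + 1) ^ 2 := fun k _ => by
    rw [dirichletFreq]; ring
  rw [Finset.sum_congr rfl this, ← Finset.mul_sum, sum_sq_symmetric]
  field_simp

end Dirichlet

/-! ### The interpolation kernels -/

/-- The `r`-th derivative of the cosine polynomial of degree `m` with coefficients `w`, in the
variable `u = m * x`, for which all frequencies lie in `[0, 2 * π]`. -/
noncomputable def cosKernel (m : ℕ) (w : ℕ → ℝ) (r : ℕ) (u : ℝ) : ℝ :=
  cosSum (Finset.range (m + 1)) w (fun k => 2 * Real.pi * k / m) r u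

/-- The curvature `∑ k, w k * θ k ^ 2` of the kernel at its peak, the negative of its second
derivative there. -/
noncomputable def curvature (m : ℕ) (w : ℕ → ℝ) : ℝ :=
  ∑ k ∈ Finset.range (m + 1), w k * (2 * Real.pi * k / m) ^ 2

theorem abs_freq_le {m n : ℕ} (hm : 0 < m) {a : ℝ} (hn : (n : ℝ) ≤ a * m) :
    ∀ k ∈ Finset.range (n + 1), |2 * Real.pi * (k : ℝ) / m| ≤ 2 * Real.pi * a := fun k hk => by
  have hk' : (k : ℝ) ≤ n := by
    rw [Finset.mem_range] at hk
    exact_mod_cast Nat.lt_succ_iff.1 hk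
  rw [abs_of_nonneg (by positivity), div_le_iff₀ (by positivity)]
  nlinarith [Real.pi_pos]

theorem IsPosCosPoly.exists_cosSum {m n : ℕ} (hm : 0 < m) {f : ℝ → ℝ}
    (hf : IsPosCosPoly n fun x => f (m * x)) :
    ∃ w : ℕ → ℝ, (∀ k, 0 ≤ w k) ∧
      cosSum (Finset.range (n + 1)) w (fun k => 2 * Real.pi * k / m) 0 = f := by
  obtain ⟨w, hw, h⟩ := hf
  refine ⟨w, hw, funext fun u => ?_⟩
  have hm' : (m : ℝ) ≠ 0 := by positivity
  have := h (u / m)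
  simp only [mul_div_cancel₀ u hm'] at this
  rw [cosSum_zero_eq, this]
  refine Finset.sum_congr rfl fun k _ => ?_
  congr 2
  ring

section CosKernel

variable {m : ℕ} {w : ℕ → ℝ}

theorem hasDerivAt_cosKernel (m : ℕ) (w : ℕ → ℝ) (r : ℕ) (u : ℝ) :
    HasDerivAt (cosKernel m w r) (cosKernel m w (r + 1) u) u :=
  hasDerivAt_cosSum _ _ _ r u

theorem cosKernel_zero_apply_zero : cosKernel m w 0 0 = ∑ k ∈ Finset.range (m + 1), w k := by
  simp [cosKernel, cosSum_zero_eq]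

theorem cosKernel_two_apply_zero : cosKernel m w 2 0 = -curvature m w :=
  cosSum_two_apply_zero

theorem freq_le_two_pi (hm : 0 < m) :
    ∀ k ∈ Finset.range (m + 1), |2 * Real.pi * (k : ℝ) / m| ≤ 2 * Real.pi := by
  simpa using abs_freq_le hm (a := 1) (by simp)

end CosKernel

/-- For degree at least `10` the fourth power of a Dirichlet kernel with `N = m / 2 + 1` terms is a
kernel of quartic decay. Being the square of a cosine sum with frequencies at most `π`, it satisfies
a comparison of values over a wider range than its own frequencies would give. -/
theorem exists_cosKernel_decay {m : ℕ} (hm : 10 ≤ m) :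
    ∃ w : ℕ → ℝ, (∀ k, 0 ≤ w k) ∧ ∑ k ∈ Finset.range (m + 1), w k = 1 ∧
      3.289 ≤ curvature m w ∧ curvature m w ≤ 4.61 ∧
      (∀ u, 0 ≤ cosKernel m w 0 u) ∧
      (∀ u u₀ : ℝ, |u₀| ≤ |u| → |u| + |u₀| ≤ 2 → cosKernel m w 0 u ≤ cosKernel m w 0 u₀) ∧
      ∀ u τ : ℝ, τ = m * |Real.sin (Real.pi / m * u)| / 2 →
        τ ^ 4 * |cosKernel m w 0 u| ≤ 1 ∧
        (2.5 ≤ τ → τ ^ 4 * |cosKernel m w 1 u| ≤ 8.8) ∧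
        (4.83 ≤ τ → τ ^ 4 * |cosKernel m w 2 u| ≤ 60.6 ∧
          τ ^ 4 * |cosKernel m w 3 u| ≤ 502) := by
  have hmr : (10 : ℝ) ≤ m := by exact_mod_cast hm
  have hm0 : 0 < m := by omega
  set N := m / 2 + 1 with hNdef
  have hN0 : 0 < N := by omega
  have hN1 : m ≤ 2 * N := by omega
  have hN1' : m + 1 ≤ 2 * N := by omega
  have hN2' : 2 * (N - 1) ≤ m := by omega
  have hN3 : (N : ℝ) ≤ m / 2 + 1 := by
    have : 2 * N ≤ m + 2 := by omega
    have : 2 * (N : ℝ) ≤ m + 2 := by exact_mod_cast this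
    linarith
  have hN2 : (N : ℝ) ≤ 0.6 * m := by linarith
  have hN1r : (m : ℝ) + 1 ≤ 2 * N := by exact_mod_cast hN1'
  have hsq := isPosCosPoly_dirichletKernel_sq hm0 hN0
  obtain ⟨v, hv, hvf⟩ := IsPosCosPoly.exists_cosSum hm0
    (f := fun u => dirichletKernel m N 0 u ^ 2) hsq
  have h4 : IsPosCosPoly m fun x => dirichletKernel m N 0 (m * x) ^ 4 := by
    convert (hsq.mul hsq).mono (n' := m) (by omega) using 2 with x
    ring
  obtain ⟨w, hw, hwf⟩ := IsPosCosPoly.exists_cosSum hm0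
    (f := fun u => dirichletKernel m N 0 u ^ 4) h4
  have k0 : ∀ u, cosKernel m w 0 u = dirichletKernel m N 0 u ^ 4 := fun u => congrFun hwf u
  have k1 : ∀ u, cosKernel m w 1 u
      = 4 * dirichletKernel m N 0 u ^ 3 * dirichletKernel m N 1 u := fun u => by
    have h := (hasDerivAt_dirichletKernel m N 0 u).fun_pow 4
    rw [(hasDerivAt_cosKernel m w 0 u).unique (h.congr_of_eventuallyEq
      (Filter.Eventually.of_forall k0))]
    norm_num
  have k2 : ∀ u, cosKernel m w 2 u = 4 * dirichletKernel m N 0 u ^ 3 * dirichletKernel m N 2 u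
      + 12 * dirichletKernel m N 0 u ^ 2 * dirichletKernel m N 1 u ^ 2 := fun u => by
    have h := (((hasDerivAt_dirichletKernel m N 0 u).fun_pow 3).const_mul 4).fun_mul
      (hasDerivAt_dirichletKernel m N 1 u)
    rw [(hasDerivAt_cosKernel m w 1 u).unique (h.congr_of_eventuallyEq
      (Filter.Eventually.of_forall k1))]
    push_cast
    ring
  have k3 : ∀ u, cosKernel m w 3 u = 4 * dirichletKernel m N 0 u ^ 3 * dirichletKernel m N 3 u
      + 36 * dirichletKernel m N 0 u ^ 2 * dirichletKernel m N 1 u * dirichletKernel m N 2 u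
      + 24 * dirichletKernel m N 0 u * dirichletKernel m N 1 u ^ 3 := fun u => by
    have h := ((((hasDerivAt_dirichletKernel m N 0 u).fun_pow 3).const_mul 4).fun_mul
      (hasDerivAt_dirichletKernel m N 2 u)).fun_add
      ((((hasDerivAt_dirichletKernel m N 0 u).fun_pow 2).const_mul 12).fun_mul
      ((hasDerivAt_dirichletKernel m N 1 u).fun_pow 2))
    rw [(hasDerivAt_cosKernel m w 2 u).unique (h.congr_of_eventuallyEq
      (Filter.Eventually.of_forall k2))]
    push_cast
    ring
  have hM : curvature m w = 4 * ((Real.pi / m) ^ 2 * ((N : ℝ) ^ 2 - 1) / 3) := by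
    have h := k2 0
    rw [cosKernel_two_apply_zero, dirichletKernel_zero_apply_zero hN0,
      dirichletKernel_two_apply_zero hN0,
      show dirichletKernel m N 1 0 = 0 from cosSum_one_apply_zero] at h
    linarith
  have hpi0 := Real.pi_gt_d4
  have hpi1 := Real.pi_lt_d4
  have hpisq0 : 9.8686 ≤ Real.pi ^ 2 := by nlinarith
  have hpisq1 : Real.pi ^ 2 ≤ 9.87 := by nlinarith
  have hq : curvature m w = 4 / 3 * Real.pi ^ 2 * (((N : ℝ) ^ 2 - 1) / m ^ 2) := by
    rw [hM]; ring
  have hq0 : 1 / 4 ≤ ((N : ℝ) ^ 2 - 1) / m ^ 2 := by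
    rw [le_div_iff₀ (by positivity)]; nlinarith
  have hq1 : ((N : ℝ) ^ 2 - 1) / m ^ 2 ≤ 0.35 := by
    rw [div_le_iff₀ (by positivity)]; nlinarith
  refine ⟨w, hw, ?_, ?_, ?_, fun u => ?_, fun u u₀ hu huu => ?_, fun u τ hτ => ?_⟩
  · rw [← cosKernel_zero_apply_zero, k0, dirichletKernel_zero_apply_zero hN0, one_pow]
  · rw [hq]; nlinarith
  · rw [hq]; nlinarith
  · rw [k0]; positivity
  · have hfreq := abs_freq_le hm0 (n := N - 1) (a := 1 / 2) (by
      have : 2 * ((N - 1 : ℕ) : ℝ) ≤ m := by exact_mod_cast hN2'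
      linarith)
    have h := cosSum_zero_le_cosSum_zero (fun k _ => hv k) hfreq hu (by nlinarith)
    rw [hvf] at h
    have h' := pow_le_pow_left₀ (sq_nonneg _) h 2
    rw [k0, k0]
    linarith
  · obtain ⟨h0, h1, h2⟩ := abs_dirichletKernel_le hm hN1 hN2 u hτ
    have hτ0 : 0 ≤ τ := by rw [hτ]; positivity
    rw [k0, k1, k2, k3]
    have g0 : 0 ≤ τ * |dirichletKernel m N 0 u| := by positivity
    have g1 : 0 ≤ τ * |dirichletKernel m N 1 u| := by positivity
    have g2 : 0 ≤ τ * |dirichletKernel m N 2 u| := by positivity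
    have g3 : 0 ≤ τ * |dirichletKernel m N 3 u| := by positivity
    have p2 := pow_le_one₀ (n := 2) g0 h0
    have p3 := pow_le_one₀ (n := 3) g0 h0
    have p4 := pow_le_one₀ (n := 4) g0 h0
    refine ⟨?_, fun ht => ?_, fun ht => ⟨?_, ?_⟩⟩
    · rwa [abs_pow, ← mul_pow]
    · have e : τ ^ 4 * |4 * dirichletKernel m N 0 u ^ 3 * dirichletKernel m N 1 u|
          = 4 * ((τ * |dirichletKernel m N 0 u|) ^ 3 * (τ * |dirichletKernel m N 1 u|)) := by
        simp only [abs_mul, abs_pow, abs_of_pos (four_pos : (0 : ℝ) < 4)]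
        ring
      have := mul_le_mul p3 (h1 ht) g1 zero_le_one
      rw [e]
      linarith
    · obtain ⟨i1, i2, -⟩ := h2 ht
      have e : τ ^ 4 * (|4 * dirichletKernel m N 0 u ^ 3 * dirichletKernel m N 2 u|
          + |12 * dirichletKernel m N 0 u ^ 2 * dirichletKernel m N 1 u ^ 2|)
          = 4 * ((τ * |dirichletKernel m N 0 u|) ^ 3 * (τ * |dirichletKernel m N 2 u|))
            + 12 * ((τ * |dirichletKernel m N 0 u|) ^ 2
              * (τ * |dirichletKernel m N 1 u|) ^ 2) := by
        simp only [abs_mul, abs_pow, abs_of_pos (four_pos : (0 : ℝ) < 4),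
          abs_of_pos (by norm_num : (0 : ℝ) < 12)]
        ring
      have j1 := mul_le_mul p3 i2 g2 zero_le_one
      have j2 := mul_le_mul p2 (pow_le_pow_left₀ g1 i1 2) (by positivity) zero_le_one
      refine (mul_le_mul_of_nonneg_left (abs_add_le _ _) (by positivity)).trans ?_
      rw [e]
      norm_num at j1 j2 ⊢
      linarith
    · obtain ⟨i1, i2, i3⟩ := h2 ht
      have e : τ ^ 4 * (|4 * dirichletKernel m N 0 u ^ 3 * dirichletKernel m N 3 u|
          + |36 * dirichletKernel m N 0 u ^ 2 * dirichletKernel m N 1 u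
            * dirichletKernel m N 2 u|
          + |24 * dirichletKernel m N 0 u * dirichletKernel m N 1 u ^ 3|)
          = 4 * ((τ * |dirichletKernel m N 0 u|) ^ 3 * (τ * |dirichletKernel m N 3 u|))
            + 36 * ((τ * |dirichletKernel m N 0 u|) ^ 2
              * ((τ * |dirichletKernel m N 1 u|) * (τ * |dirichletKernel m N 2 u|)))
            + 24 * ((τ * |dirichletKernel m N 0 u|)
              * (τ * |dirichletKernel m N 1 u|) ^ 3) := by
        simp only [abs_mul, abs_pow, abs_of_pos (four_pos : (0 : ℝ) < 4),
          abs_of_pos (by norm_num : (0 : ℝ) < 36), abs_of_pos (by norm_num : (0 : ℝ) < 24)]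
        ring
      have j1 := mul_le_mul p3 i3 g3 zero_le_one
      have j2 := mul_le_mul p2 (mul_le_mul i1 i2 g2 (by norm_num)) (by positivity) zero_le_one
      have j3 := mul_le_mul h0 (pow_le_pow_left₀ g1 i1 3) (by positivity) zero_le_one
      refine (mul_le_mul_of_nonneg_left (abs_add_three _ _ _) (by positivity)).trans ?_
      rw [e]
      norm_num at j1 j2 j3 ⊢
      linarith

/-- For degree at most `9`, where there is at most one node, `cos (π * x) ^ (2 * m)` is a suitable
kernel. -/
theorem exists_cosKernel_small {m : ℕ} (hm : 1 ≤ m) (hm9 : m ≤ 9) :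
    ∃ w : ℕ → ℝ, (∀ k, 0 ≤ w k) ∧ ∑ k ∈ Finset.range (m + 1), w k = 1 ∧
      2.19 ≤ curvature m w ∧ curvature m w ≤ 20 ∧
      (∀ u, 0 ≤ cosKernel m w 0 u) ∧
      (∀ u u₀ : ℝ, |u₀| ≤ |u| → |u| ≤ m / 2 → cosKernel m w 0 u ≤ cosKernel m w 0 u₀) := by
  have hm0 : 0 < m := hm
  have hmr : (1 : ℝ) ≤ m := by exact_mod_cast hm
  have hmr9 : (m : ℝ) ≤ 9 := by exact_mod_cast hm9
  set h := Real.pi / m with hh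
  have hmh : m * h = Real.pi := by rw [hh]; field_simp
  have hh0 : 0 < h := by rw [hh]; positivity
  have hcos : IsPosCosPoly 1 fun x => Real.cos (h * (m * x)) ^ 2 := by
    have e : (fun x => Real.cos (h * (m * x)) ^ 2) = fun x =>
        1 / 2 * Real.cos (2 * Real.pi * ((0 : ℤ) : ℝ) * x)
          + 1 / 2 * Real.cos (2 * Real.pi * ((1 : ℤ) : ℝ) * x) := by
      funext x
      rw [Real.cos_sq, ← hmh]
      simp only [Int.cast_zero, Int.cast_one, mul_zero, zero_mul, Real.cos_zero]
      ring_nf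
    rw [e]
    exact ((IsPosCosPoly.cos _ (by simp)).const_mul (by norm_num)).add
      ((IsPosCosPoly.cos _ (by simp)).const_mul (by norm_num))
  have hpow : ∀ j : ℕ, IsPosCosPoly j fun x => (Real.cos (h * (m * x)) ^ 2) ^ j := by
    intro j
    induction j with
    | zero => simpa using IsPosCosPoly.cos (n := 0) 0 (by simp)
    | succ j ih => simpa only [pow_succ _ j] using ih.mul hcos
  obtain ⟨w, hw, hwf⟩ := IsPosCosPoly.exists_cosSum hm0
    (f := fun u => (Real.cos (h * u) ^ 2) ^ m) (hpow m)
  have k0 : ∀ u, cosKernel m w 0 u = Real.cos (h * u) ^ (2 * m) := fun u => by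
    rw [pow_mul]
    exact congrFun hwf u
  have dcos : ∀ u, HasDerivAt (fun u => Real.cos (h * u)) (-Real.sin (h * u) * (h * 1)) u :=
    fun u => ((hasDerivAt_id u).const_mul h).cos
  have k1 : ∀ u, cosKernel m w 1 u
      = (-2 * Real.pi) * (Real.cos (h * u) ^ (2 * m - 1) * Real.sin (h * u)) := fun u => by
    rw [(hasDerivAt_cosKernel m w 0 u).unique (((dcos u).fun_pow (2 * m)).congr_of_eventuallyEq
      (Filter.Eventually.of_forall k0)), ← hmh]
    push_cast
    ring
  have hM : curvature m w = 2 * Real.pi * h := by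
    have hs : HasDerivAt (fun u => Real.sin (h * u)) (Real.cos (h * 0) * (h * 1)) 0 :=
      ((hasDerivAt_id (0 : ℝ)).const_mul h).sin
    have h2 := (((dcos 0).fun_pow (2 * m - 1)).fun_mul hs).const_mul (-2 * Real.pi)
    have h3 := (hasDerivAt_cosKernel m w 1 0).unique (h2.congr_of_eventuallyEq
      (Filter.Eventually.of_forall k1))
    rw [cosKernel_two_apply_zero] at h3
    simp at h3
    linarith
  have hpi0 := Real.pi_gt_d4
  have hpi1 := Real.pi_lt_d4
  have hpisq0 : 9.8686 ≤ Real.pi * Real.pi := by nlinarith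
  have hpisq1 : Real.pi * Real.pi ≤ 9.87 := by nlinarith
  have hM' : curvature m w = 2 * (Real.pi * Real.pi) / m := by rw [hM, hh]; ring
  refine ⟨w, hw, ?_, ?_, ?_, fun u => ?_, fun u u₀ hu huu => ?_⟩
  · rw [← cosKernel_zero_apply_zero, k0]
    simp
  · rw [hM', le_div_iff₀ (by linarith)]
    linarith
  · rw [hM', div_le_iff₀ (by linarith)]
    linarith
  · rw [k0, pow_mul]
    positivity
  · rw [k0, k0, ← Real.cos_abs (h * u), ← Real.cos_abs (h * u₀), abs_mul, abs_mul,
      abs_of_pos hh0]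
    have hup : h * |u| ≤ Real.pi / 2 := by
      rw [← hmh]
      nlinarith
    have h1 : h * |u₀| ≤ h * |u| := mul_le_mul_of_nonneg_left hu hh0.le
    exact pow_le_pow_left₀ (Real.cos_nonneg_of_neg_pi_div_two_le_of_le
      (by have := abs_nonneg u; have : 0 ≤ h * |u| := by positivity
          linarith) hup)
      (Real.cos_le_cos_of_nonneg_of_le_pi (by positivity) (by linarith) h1) _

/-! ### The wrap-around distance and sums over separated points -/

theorem wrapDist_nonneg (x y : ℝ) : 0 ≤ wrapDist x y := dist_nonneg

theorem wrapDist_comm (x y : ℝ) : wrapDist x y = wrapDist y x := dist_comm _ _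

theorem wrapDist_triangle (x y z : ℝ) : wrapDist x z ≤ wrapDist x y + wrapDist y z :=
  dist_triangle _ _ _

theorem wrapDist_le_abs_sub (x y : ℝ) (n : ℤ) : wrapDist x y ≤ |x - y - n| := by
  rw [wrapDist_eq]
  exact round_le _ _

theorem wrapDist_le_half (x y : ℝ) : wrapDist x y ≤ 1 / 2 := by
  rw [wrapDist_eq]
  exact abs_sub_round _

/-- Jordan's inequality for the sine, extended periodically. -/
theorem two_mul_wrapDist_le_abs_sin (x y : ℝ) :
    2 * wrapDist x y ≤ |Real.sin (Real.pi * (x - y))| := by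
  set n := round (x - y) with hn
  have h1 : |Real.sin (Real.pi * (x - y))| = |Real.sin (Real.pi * (x - y - n))| := by
    rw [show Real.pi * (x - y - n) = Real.pi * (x - y) - n * Real.pi by ring,
      Real.sin_sub_int_mul_pi, abs_mul]
    simp
  rw [h1, wrapDist_eq, ← hn]
  have h2 : |x - y - n| ≤ 1 / 2 := abs_sub_round _
  have h3 := Real.mul_abs_le_abs_sin (x := Real.pi * (x - y - n)) (by
    rw [abs_mul, abs_of_pos Real.pi_pos]
    nlinarith [Real.pi_pos])
  rw [abs_mul, abs_of_pos Real.pi_pos] at h3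
  calc 2 * |x - y - n| = 2 / Real.pi * (Real.pi * |x - y - n|) := by
        field_simp
    _ ≤ _ := h3

theorem le_wrapDist_of_le_minSeparation {T : Finset ℝ} {δ : ℝ}
    (h : ENNReal.ofReal δ ≤ minSeparation T) :
    ∀ s ∈ T, ∀ t ∈ T, s ≠ t → δ ≤ wrapDist s t := by
  intro s hs t ht hst
  simp only [minSeparation, le_iInf_iff] at h
  exact (ENNReal.ofReal_le_ofReal_iff (wrapDist_nonneg s t)).1 (h s hs t ht hst)

/-- The bound for one side of the circle: by convexity each term `1 / β ^ 4` with `β ≥ α + 5` is at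
most `1 / 5` times the integral of `1 / y ^ 4` over an interval of length `5` centered at `β`, and
these intervals do not overlap. -/
theorem sum_inv_pow_four_le {S : Finset ℝ} {α : ℝ} (hα : 0 < α) (hS : ∀ y ∈ S, α ≤ y)
    (hsep : ∀ y ∈ S, ∀ z ∈ S, y ≠ z → 5 ≤ |y - z|) :
    ∑ y ∈ S, 1 / y ^ 4 ≤ 1 / α ^ 4 + 1 / (15 * (α + 2.5) ^ 3) := by
  induction hn : S.card generalizing S α with
  | zero =>
    rw [Finset.card_eq_zero.1 hn, Finset.sum_empty]
    positivity
  | succ n ih =>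
    have hne : S.Nonempty := Finset.card_pos.1 (by omega)
    set y₀ := S.min' hne with hy₀
    have hmem : y₀ ∈ S := S.min'_mem hne
    have hrest := ih (S := S.erase y₀) (α := α + 5) (by linarith)
      (fun y hy => by
        have hy' := Finset.mem_of_mem_erase hy
        have h1 := hsep y hy' y₀ hmem (Finset.ne_of_mem_erase hy)
        have h2 : y₀ ≤ y := S.min'_le y hy'
        rw [abs_of_nonneg (by linarith)] at h1
        linarith [hS y₀ hmem])
      (fun y hy z hz => hsep y (Finset.mem_of_mem_erase hy) z (Finset.mem_of_mem_erase hz))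
      (by rw [Finset.card_erase_of_mem hmem, hn]; rfl)
    rw [← Finset.add_sum_erase S _ hmem]
    have h1 : 1 / y₀ ^ 4 ≤ 1 / α ^ 4 :=
      one_div_le_one_div_of_le (by positivity) (pow_le_pow_left₀ hα.le (hS y₀ hmem) 4)
    have h2 : 1 / (α + 5) ^ 4 + 1 / (15 * (α + 5 + 2.5) ^ 3) ≤ 1 / (15 * (α + 2.5) ^ 3) := by
      set p := α + 2.5 with hp
      set q := α + 5 + 2.5 with hq
      have hp0 : 0 < p := by rw [hp]; linarith
      have hq0 : 0 < q := by rw [hq]; linarith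
      have hpq : q - p = 5 := by rw [hp, hq]; ring
      have hβ : (α + 5) ^ 2 = p * q + 2.5 ^ 2 := by rw [hp, hq]; ring
      have h3 : 1 / (15 * p ^ 3) - 1 / (15 * q ^ 3) =
          (q - p) * (p ^ 2 + p * q + q ^ 2) / (15 * (p * q) ^ 3) := by
        field_simp
        ring
      have h4 : 1 / (p * q) ^ 2 ≤ (q - p) * (p ^ 2 + p * q + q ^ 2) / (15 * (p * q) ^ 3) := by
        rw [hpq, div_le_div_iff₀ (by positivity) (by positivity)]
        have : 3 * (p * q) ≤ p ^ 2 + p * q + q ^ 2 := by nlinarith [sq_nonneg (p - q)]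
        have h6 := mul_le_mul_of_nonneg_right this (by positivity : 0 ≤ 5 * (p * q) ^ 2)
        linarith
      have h5 : 1 / (α + 5) ^ 4 ≤ 1 / (p * q) ^ 2 := by
        refine one_div_le_one_div_of_le (by positivity) ?_
        rw [show (α + 5) ^ 4 = ((α + 5) ^ 2) ^ 2 by ring]
        exact pow_le_pow_left₀ (by positivity) (by rw [hβ]; norm_num) 2
      linarith
    linarith

theorem sum_inv_wrapDist_pow_four_le {m : ℕ} (hm : 0 < m) {S : Finset ℝ}
    (hsep : ∀ s ∈ S, ∀ t ∈ S, s ≠ t → 5 / (m : ℝ) ≤ wrapDist s t) (x : ℝ) {α : ℝ} (hα : 0 < α)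
    (hS : ∀ k ∈ S, α ≤ m * wrapDist x k) :
    ∑ k ∈ S, 1 / (m * wrapDist x k) ^ 4 ≤ 2 * (1 / α ^ 4 + 1 / (15 * (α + 2.5) ^ 3)) := by
  classical
  have hmr : (0 : ℝ) < m := by exact_mod_cast hm
  set y : ℝ → ℝ := fun k => m * (x - k - round (x - k)) with hy
  have habs : ∀ k, |y k| = m * wrapDist x k := fun k => by
    rw [hy, wrapDist_eq, abs_mul, abs_of_pos hmr]
  have hysep : ∀ s ∈ S, ∀ t ∈ S, s ≠ t → 5 ≤ |y s - y t| := fun s hs t ht hst => by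
    have h1 := hsep s hs t ht hst
    have h2 := wrapDist_le_abs_sub s t (round (x - t) - round (x - s))
    rw [div_le_iff₀' hmr] at h1
    have h3 : |y s - y t| = m * |s - t - ((round (x - t) - round (x - s) : ℤ) : ℝ)| := by
      have e : y s - y t = -(m * (s - t - ((round (x - t) - round (x - s) : ℤ) : ℝ))) := by
        simp only [hy]
        push_cast
        ring
      rw [e, abs_neg, abs_mul, abs_of_pos hmr]
    rw [h3]
    exact h1.trans (mul_le_mul_of_nonneg_left h2 hmr.le)
  have side : ∀ S' ⊆ S, (∀ s ∈ S', ∀ t ∈ S', |(|y s| - |y t|)| = |y s - y t|) →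
      ∑ k ∈ S', 1 / (m * wrapDist x k) ^ 4 ≤ 1 / α ^ 4 + 1 / (15 * (α + 2.5) ^ 3) := by
    intro S' hS' hsgn
    have hinj : Set.InjOn (fun k => |y k|) S' := fun s hs t ht hst => by
      by_contra hne
      have h1 := hysep s (hS' hs) t (hS' ht) hne
      rw [← hsgn s hs t ht, sub_eq_zero.2 hst, abs_zero] at h1
      linarith
    have hle := sum_inv_pow_four_le (S := S'.image fun k => |y k|) hα
      (fun z hz => by
        obtain ⟨k, hk, rfl⟩ := Finset.mem_image.1 hz
        rw [habs]
        exact hS k (hS' hk))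
      (fun z hz z' hz' hne => by
        obtain ⟨k, hk, rfl⟩ := Finset.mem_image.1 hz
        obtain ⟨l, hl, rfl⟩ := Finset.mem_image.1 hz'
        rw [hsgn k hk l hl]
        exact hysep k (hS' hk) l (hS' hl) fun h => hne (by rw [h]))
    rw [Finset.sum_image hinj] at hle
    simpa only [habs] using hle
  rw [← Finset.sum_filter_add_sum_filter_not S (fun k => 0 ≤ y k), two_mul]
  refine add_le_add (side _ (Finset.filter_subset _ _) fun s hs t ht => ?_)
    (side _ (Finset.filter_subset _ _) fun s hs t ht => ?_)
  · rw [abs_of_nonneg (Finset.mem_filter.1 hs).2, abs_of_nonneg (Finset.mem_filter.1 ht).2]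
  · rw [abs_of_neg (not_le.1 (Finset.mem_filter.1 hs).2),
      abs_of_neg (not_le.1 (Finset.mem_filter.1 ht).2), ← abs_neg]
    ring_nf

/-! ### A diagonally dominant Hermite interpolation system -/

/-- The linear system for the coefficients of a Hermite interpolant. A solution is controlled by the
data in the supremum norm, through the row sums off the diagonal. If these are so small that the
resulting inequalities for zero data admit only the zero solution, which is the hypothesis `hdet`,
the system is injective, hence solvable. -/
theorem exists_hermite_solution {ι : Type*} [Fintype ι] [DecidableEq ι]
    (E0 E1 E2 : ι → ι → ℝ) {M S0 S1 S2 : ℝ}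
    (h0 : ∀ j, E0 j j = 1) (h1 : ∀ j, E1 j j = 0) (h2 : ∀ j, E2 j j = -M) (hM : 0 ≤ M)
    (hS0 : ∀ j, ∑ k ∈ Finset.univ.erase j, |E0 j k| ≤ S0)
    (hS1 : ∀ j, ∑ k ∈ Finset.univ.erase j, |E1 j k| ≤ S1)
    (hS2 : ∀ j, ∑ k ∈ Finset.univ.erase j, |E2 j k| ≤ S2)
    (hdet : ∀ A B : ℝ, 0 ≤ A → 0 ≤ B → A ≤ S0 * A + S1 * B → M * B ≤ S1 * A + S2 * B →
      A = 0 ∧ B = 0) (v v' : ι → ℂ) :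
    ∃ a b : ι → ℂ,
      (∀ j, ∑ k, (a k * E0 j k + b k * E1 j k) = v j) ∧
      (∀ j, ∑ k, (a k * E1 j k + b k * E2 j k) = v' j) ∧
      (∀ j, ‖a j - v j‖ ≤ S0 * ‖a‖ + S1 * ‖b‖) ∧
      (∀ j, M * ‖b j‖ ≤ ‖v'‖ + S1 * ‖a‖ + S2 * ‖b‖) := by
  have off : ∀ (E E' : ι → ι → ℝ) (S S' : ℝ) (j : ι) (a b : ι → ℂ),
      ∑ k ∈ Finset.univ.erase j, |E j k| ≤ S → ∑ k ∈ Finset.univ.erase j, |E' j k| ≤ S' →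
      ‖∑ k ∈ Finset.univ.erase j, (a k * E j k + b k * E' j k)‖ ≤ S * ‖a‖ + S' * ‖b‖ := by
    intro E E' S S' j a b hS hS'
    have h : ∀ (F : ι → ι → ℝ) (c : ι → ℂ) (R : ℝ), ∑ k ∈ Finset.univ.erase j, |F j k| ≤ R →
        ∑ k ∈ Finset.univ.erase j, ‖c k * F j k‖ ≤ R * ‖c‖ := fun F c R hR => by
      refine le_trans ?_ (mul_le_mul_of_nonneg_right hR (norm_nonneg c))
      rw [Finset.sum_mul]
      refine Finset.sum_le_sum fun k _ => ?_
      rw [norm_mul, Complex.norm_real, Real.norm_eq_abs, mul_comm]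
      exact mul_le_mul_of_nonneg_left (norm_le_pi_norm c k) (abs_nonneg _)
    refine (norm_sum_le _ _).trans ((Finset.sum_le_sum fun k _ => norm_add_le _ _).trans ?_)
    rw [Finset.sum_add_distrib]
    exact add_le_add (h E a S hS) (h E' b S' hS')
  have bounds : ∀ a b v v' : ι → ℂ, (∀ j, ∑ k, (a k * E0 j k + b k * E1 j k) = v j) →
      (∀ j, ∑ k, (a k * E1 j k + b k * E2 j k) = v' j) →
      (∀ j, ‖a j - v j‖ ≤ S0 * ‖a‖ + S1 * ‖b‖) ∧
      (∀ j, M * ‖b j‖ ≤ ‖v'‖ + S1 * ‖a‖ + S2 * ‖b‖) := by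
    intro a b v v' hv hv'
    refine ⟨fun j => ?_, fun j => ?_⟩
    · have h := hv j
      rw [← Finset.add_sum_erase _ _ (Finset.mem_univ j), h0, h1] at h
      rw [← norm_neg, show -(a j - v j)
        = ∑ k ∈ Finset.univ.erase j, (a k * E0 j k + b k * E1 j k) by
          push_cast at h
          linear_combination -h]
      exact off E0 E1 S0 S1 j a b (hS0 j) (hS1 j)
    · have h := hv' j
      rw [← Finset.add_sum_erase _ _ (Finset.mem_univ j), h1, h2] at h
      have e : (M : ℂ) * b j
          = -(v' j) + ∑ k ∈ Finset.univ.erase j, (a k * E1 j k + b k * E2 j k) := by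
        push_cast at h
        linear_combination -h
      have e2 : M * ‖b j‖ = ‖(M : ℂ) * b j‖ := by
        rw [norm_mul, Complex.norm_real, Real.norm_eq_abs, abs_of_nonneg hM]
      rw [e2, e, add_assoc]
      refine (norm_add_le _ _).trans (add_le_add ?_ (off E1 E2 S1 S2 j a b (hS1 j) (hS2 j)))
      rw [norm_neg]
      exact norm_le_pi_norm v' j
  let Φ : ((ι → ℂ) × (ι → ℂ)) →ₗ[ℂ] ((ι → ℂ) × (ι → ℂ)) :=
    { toFun := fun c => (fun j => ∑ k, (c.1 k * E0 j k + c.2 k * E1 j k),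
        fun j => ∑ k, (c.1 k * E1 j k + c.2 k * E2 j k))
      map_add' := fun c c' => by
        ext j <;> simp only [Prod.fst_add, Prod.snd_add, Pi.add_apply, ← Finset.sum_add_distrib] <;>
          exact Finset.sum_congr rfl fun k _ => by ring
      map_smul' := fun r c => by
        ext j <;> simp only [Prod.smul_fst, Prod.smul_snd, Pi.smul_apply, smul_eq_mul,
          RingHom.id_apply, Finset.mul_sum] <;>
          exact Finset.sum_congr rfl fun k _ => by ring }
  have hinj : Function.Injective Φ := by
    rw [← LinearMap.ker_eq_bot, LinearMap.ker_eq_bot']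
    rintro ⟨a, b⟩ hab
    obtain ⟨e1, e2⟩ := Prod.mk.inj hab
    obtain ⟨i1, i2⟩ := bounds a b 0 0 (fun j => congrFun e1 j) (fun j => congrFun e2 j)
    have hSn : ∀ j, 0 ≤ S0 * ‖a‖ + S1 * ‖b‖ := fun j => (norm_nonneg _).trans (i1 j)
    obtain ⟨hA, hB⟩ : ‖a‖ = 0 ∧ ‖b‖ = 0 := by
      rcases isEmpty_or_nonempty ι with hι | ⟨⟨j₀⟩⟩
      · exact ⟨by rw [Subsingleton.elim a 0, norm_zero], by rw [Subsingleton.elim b 0, norm_zero]⟩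
      · refine hdet _ _ (norm_nonneg a) (norm_nonneg b) ?_ ?_
        · exact (pi_norm_le_iff_of_nonneg (hSn j₀)).2 fun j => by simpa using i1 j
        · have h3 : ∀ j, M * ‖b j‖ ≤ S1 * ‖a‖ + S2 * ‖b‖ := fun j => by simpa using i2 j
          have h4 : ‖(M : ℂ) • b‖ ≤ S1 * ‖a‖ + S2 * ‖b‖ :=
            (pi_norm_le_iff_of_nonneg ((mul_nonneg hM (norm_nonneg (b j₀))).trans (h3 j₀))).2
              fun j => by
                rw [Pi.smul_apply, norm_smul, Complex.norm_real, Real.norm_eq_abs,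
                  abs_of_nonneg hM]
                exact h3 j
          rwa [norm_smul, Complex.norm_real, Real.norm_eq_abs, abs_of_nonneg hM] at h4
    rw [norm_eq_zero.1 hA, norm_eq_zero.1 hB]
    rfl
  obtain ⟨⟨a, b⟩, hab⟩ := (LinearMap.injective_iff_surjective.1 hinj) (v, v')
  obtain ⟨e1, e2⟩ := Prod.mk.inj hab
  exact ⟨a, b, fun j => congrFun e1 j, fun j => congrFun e2 j,
    bounds a b v v' (fun j => congrFun e1 j) (fun j => congrFun e2 j)⟩

/-! ### Hermite interpolants with a kernel at each node -/

/-- The `r`-th derivative, up to the factor `m ^ r`, of the combination of translates of a kernel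
and of its derivative with coefficients `a` and `b`. -/
noncomputable def hermiteSum (m : ℕ) (w : ℕ → ℝ) {T : Finset ℝ} (a b : T → ℂ) (r : ℕ) (x : ℝ) : ℂ :=
  ∑ k : T, (a k * cosKernel m w r (m * (x - k)) + b k * cosKernel m w (r + 1) (m * (x - k)))

section HermiteSum

variable {m : ℕ} {w : ℕ → ℝ} {T : Finset ℝ}

theorem cosKernel_sub_int_mul (hm : 0 < m) (r : ℕ) (x : ℝ) (n : ℤ) :
    cosKernel m w r (m * (x - n)) = cosKernel m w r (m * x) := by
  have hm' : (m : ℝ) ≠ 0 := by positivity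
  rw [cosKernel, cosKernel, cosSum, cosSum]
  refine Finset.sum_congr rfl fun k _ => ?_
  congr 1
  rw [show 2 * Real.pi * (k : ℝ) / m * (m * (x - n)) + r * (Real.pi / 2)
    = 2 * Real.pi * (k : ℝ) / m * (m * x) + r * (Real.pi / 2)
      - ((k * n : ℤ) : ℝ) * (2 * Real.pi) by
        push_cast
        field_simp
        ring]
  exact Real.cos_sub_int_mul_two_pi _ _

theorem isTrigPoly_hermiteSum (hm : 0 < m) (a b : T → ℂ) : IsTrigPoly m (hermiteSum m w a b 0) :=
  .sum _ fun k _ => .add (.const_mul (.cosSum_sub hm le_rfl w 0 k) _)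
    (.const_mul (.cosSum_sub hm le_rfl w 1 k) _)

theorem hasDerivAt_hermiteSum (a b : T → ℂ) (r : ℕ) (x : ℝ) :
    HasDerivAt (hermiteSum m w a b r) (m * hermiteSum m w a b (r + 1) x) x := by
  have hk : ∀ (k : ℝ) (r : ℕ), HasDerivAt (fun x => (cosKernel m w r (m * (x - k)) : ℂ))
      (m * cosKernel m w (r + 1) (m * (x - k)) : ℂ) x := fun k r => by
    have := ((hasDerivAt_cosKernel m w r (m * (x - k))).comp x
      (((hasDerivAt_id x).sub_const k).const_mul (m : ℝ))).ofReal_comp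
    refine this.congr_deriv ?_
    push_cast
    ring
  rw [hermiteSum, Finset.mul_sum]
  refine HasDerivAt.fun_sum fun k _ => ?_
  refine (((hk k r).const_mul (a k)).fun_add ((hk k (r + 1)).const_mul (b k))).congr_deriv ?_
  ring

theorem sum_abs_cosKernel_le (hm : 0 < m)
    (hsep : ∀ s ∈ T, ∀ t ∈ T, s ≠ t → 5 / (m : ℝ) ≤ wrapDist s t) {r : ℕ} {α c : ℝ} (hα : 0 < α)
    (hc0 : 0 ≤ c)
    (hc : ∀ u τ : ℝ, τ = m * |Real.sin (Real.pi / m * u)| / 2 → α ≤ τ →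
      τ ^ 4 * |cosKernel m w r u| ≤ c) (x : ℝ) (S : Finset T)
    (hS : ∀ k ∈ S, α ≤ m * wrapDist x k) :
    ∑ k ∈ S, |cosKernel m w r (m * (x - k))|
      ≤ c * (2 * (1 / α ^ 4 + 1 / (15 * (α + 2.5) ^ 3))) := by
  have hmr : (0 : ℝ) < m := by exact_mod_cast hm
  have hterm : ∀ k ∈ S,
      |cosKernel m w r (m * (x - k))| ≤ c * (1 / (m * wrapDist x k) ^ 4) := fun k hk => by
    have h1 := two_mul_wrapDist_le_abs_sin x k
    have hpos : 0 < m * wrapDist x k := hα.trans_le (hS k hk)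
    have h2 : m * wrapDist x k ≤ m * |Real.sin (Real.pi / m * (m * (x - k)))| / 2 := by
      rw [show Real.pi / m * (m * (x - k)) = Real.pi * (x - k) by field_simp]
      nlinarith
    have h3 := hc _ _ rfl ((hS k hk).trans h2)
    have h4 := mul_le_mul_of_nonneg_right (pow_le_pow_left₀ hpos.le h2 4)
      (abs_nonneg (cosKernel m w r (m * (x - k))))
    rw [mul_one_div, le_div_iff₀ (by positivity), mul_comm]
    exact h4.trans h3
  refine (Finset.sum_le_sum hterm).trans ?_
  rw [← Finset.mul_sum]
  refine mul_le_mul_of_nonneg_left ?_ hc0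
  have h := sum_inv_wrapDist_pow_four_le hm (S := S.map (Function.Embedding.subtype _))
    (fun s hs t ht => by
      obtain ⟨s', -, rfl⟩ := Finset.mem_map.1 hs
      obtain ⟨t', -, rfl⟩ := Finset.mem_map.1 ht
      exact hsep _ s'.2 _ t'.2) x hα
    (fun k hk => by
      obtain ⟨k', hk', rfl⟩ := Finset.mem_map.1 hk
      exact hS k' hk')
  rwa [Finset.sum_map] at h

theorem norm_sum_mul_le {ι : Type*} (S : Finset ι) {a b : ι → ℂ} {f g : ι → ℝ} {A B F G : ℝ}
    (ha : ∀ k, ‖a k‖ ≤ A) (hb : ∀ k, ‖b k‖ ≤ B) (hA : 0 ≤ A) (hB : 0 ≤ B)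
    (hF : ∑ k ∈ S, |f k| ≤ F) (hG : ∑ k ∈ S, |g k| ≤ G) :
    ‖∑ k ∈ S, (a k * f k + b k * g k)‖ ≤ A * F + B * G := by
  refine (norm_sum_le _ _).trans ?_
  calc ∑ k ∈ S, ‖a k * f k + b k * g k‖ ≤ ∑ k ∈ S, (A * |f k| + B * |g k|) := by
        refine Finset.sum_le_sum fun k _ => (norm_add_le _ _).trans ?_
        rw [norm_mul, norm_mul, Complex.norm_real, Complex.norm_real, Real.norm_eq_abs,
          Real.norm_eq_abs]
        exact add_le_add (mul_le_mul_of_nonneg_right (ha k) (abs_nonneg _))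
          (mul_le_mul_of_nonneg_right (hb k) (abs_nonneg _))
    _ = A * ∑ k ∈ S, |f k| + B * ∑ k ∈ S, |g k| := by
        rw [Finset.sum_add_distrib, Finset.mul_sum, Finset.mul_sum]
    _ ≤ A * F + B * G :=
        add_le_add (mul_le_mul_of_nonneg_left hF hA) (mul_le_mul_of_nonneg_left hG hB)

/-- By periodicity the kernel at a node `t` may be evaluated at the signed distance from `t`. -/
theorem exists_abs_eq_wrapDist (hm : 0 < m) (x t : ℝ) : ∃ u : ℝ, |u| = m * wrapDist x t ∧
    ∀ (w : ℕ → ℝ) (r : ℕ), cosKernel m w r (m * (x - t)) = cosKernel m w r u := by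
  refine ⟨m * (x - t - round (x - t)), ?_, fun w r => (cosKernel_sub_int_mul hm r _ _).symm⟩
  rw [abs_mul, wrapDist_eq, Nat.abs_cast]

/-- The second derivative of an interpolant near a node, rotated by the prescribed phase, when the
coefficients at that node are `α` and `β` after rotation and the other nodes contribute `R`. -/
theorem second_deriv_near_node (hm : 0 < m) (hw : ∀ k, 0 ≤ w k) {α β R : ℂ} {εa εb r2 u : ℝ}
    (hα : ‖α - 1‖ ≤ εa) (hβ : ‖β‖ ≤ εb) (hR : ‖R‖ ≤ r2) (hu : |u| ≤ 0.16749) :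
    (α * cosKernel m w 2 u + β * cosKernel m w 3 u + R).re
        ≤ -(0.484 - εa - 6.2832 * εb) * curvature m w + r2 ∧
      |(α * cosKernel m w 2 u + β * cosKernel m w 3 u + R).im|
        ≤ (εa + 6.2832 * εb) * curvature m w + r2 ∧
      ‖α * cosKernel m w 2 u + β * cosKernel m w 3 u + R‖
        ≤ (1 + εa + 6.2832 * εb) * curvature m w + r2 := by
  have hfreq := freq_le_two_pi hm
  have c2 : cosKernel m w 2 u ≤ -(0.484 * curvature m w) := cosSum_two_le (fun k _ => hw k) hfreq hu
  have c2' : |cosKernel m w 2 u| ≤ curvature m w := abs_cosSum_two_le (fun k _ => hw k) u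
  have c3 : |cosKernel m w 3 u| ≤ 2 * Real.pi * curvature m w :=
    abs_cosSum_three_le (fun k _ => hw k) hfreq u
  have hM : 0 ≤ curvature m w := (abs_nonneg _).trans c2'
  have c3' : |cosKernel m w 3 u| ≤ 6.2832 * curvature m w :=
    c3.trans (mul_le_mul_of_nonneg_right (by linarith [Real.pi_lt_d4]) hM)
  set C2 := cosKernel m w 2 u
  set C3 := cosKernel m w 3 u
  set E := (α - 1) * C2 + β * C3 + R with hE
  have hEn : ‖E‖ ≤ (εa + 6.2832 * εb) * curvature m w + r2 := by
    rw [hE]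
    refine (norm_add_le _ _).trans (add_le_add ((norm_add_le _ _).trans ?_) hR)
    rw [norm_mul, norm_mul, Complex.norm_real, Complex.norm_real, Real.norm_eq_abs,
      Real.norm_eq_abs]
    have h1 := mul_le_mul hα c2' (abs_nonneg _) ((norm_nonneg _).trans hα)
    have h2 := mul_le_mul hβ c3' (abs_nonneg _) ((norm_nonneg _).trans hβ)
    linarith
  have e : α * C2 + β * C3 + R = (C2 : ℂ) + E := by rw [hE]; ring
  rw [e]
  have h1 := (Complex.abs_re_le_norm E).trans hEn
  have h2 := (Complex.abs_im_le_norm E).trans hEn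
  refine ⟨?_, ?_, ?_⟩
  · rw [Complex.add_re, Complex.ofReal_re]
    linarith [le_abs_self E.re]
  · rwa [Complex.add_im, Complex.ofReal_im, zero_add]
  · refine (norm_add_le _ _).trans ?_
    rw [Complex.norm_real, Real.norm_eq_abs]
    linarith

end HermiteSum

/-! ### Peak interpolants -/

/-- A trigonometric polynomial `q`, with `q1` and `q2` its first two derivatives in the variable
`u = m * x`, that has values `v` and slopes `v'` at the nodes, has near each node a second
derivative pointing against the phase `ω`, and is bounded in modulus by a constant below
`1 - 0.34 * 0.16749 ^ 2` off the nodes. The constants leave room for multiplication by a window. -/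
structure IsPeakInterpolant (m : ℕ) (T : Finset ℝ) (ω v v' q q1 q2 : ℝ → ℂ) : Prop where
  isTrigPoly : IsTrigPoly m q
  hasDerivAt : ∀ x, HasDerivAt q (m * q1 x) x
  hasDerivAt_one : ∀ x, HasDerivAt q1 (m * q2 x) x
  apply_node : ∀ t ∈ T, q t = v t
  one_apply_node : ∀ t ∈ T, q1 t = v' t
  near : ∀ t ∈ T, ∀ u : ℝ, |u| ≤ 0.16749 →
    (starRingEnd ℂ (ω t) * q2 (t + u / m)).re ≤ -1 ∧
      |(starRingEnd ℂ (ω t) * q2 (t + u / m)).im| ≤ 0.63 ∧ ‖q2 (t + u / m)‖ ≤ 21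
  far : ∀ x, (∀ t ∈ T, 0.16749 / (m : ℝ) < wrapDist x t) → ‖q x‖ ≤ 0.985

section PeakInterpolant

variable {m : ℕ} {w : ℕ → ℝ} {T : Finset ℝ}

theorem le_wrapDist_of_ne (hm : 0 < m)
    (hsep : ∀ s ∈ T, ∀ t ∈ T, s ≠ t → 5 / (m : ℝ) ≤ wrapDist s t) {x d : ℝ} {j k : T} (hjk : k ≠ j)
    (hj : m * wrapDist x j ≤ d) : 5 - d ≤ m * wrapDist x k := by
  have hmr : (0 : ℝ) < m := by exact_mod_cast hm
  have h1 := hsep k k.2 j j.2 fun h => hjk (Subtype.ext h)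
  rw [div_le_iff₀' hmr] at h1
  have h2 := mul_le_mul_of_nonneg_left (wrapDist_triangle k x j) hmr.le
  rw [wrapDist_comm k x] at h2
  linarith

/-- The parts of the construction that are common to the kernels for small and for large degree:
what remains is to bound the coefficients and the contributions of all but one node. -/
theorem isPeakInterpolant_hermiteSum (hm : 0 < m) (hw : ∀ k, 0 ≤ w k) {ω v v' : ℝ → ℂ}
    (hω : ∀ t ∈ T, ‖ω t‖ = 1) {a b : T → ℂ}
    (hv : ∀ j : T, ∑ k : T, (a k * cosKernel m w 0 (m * (j - k))
      + b k * cosKernel m w 1 (m * (j - k))) = v j)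
    (hv' : ∀ j : T, ∑ k : T, (a k * cosKernel m w 1 (m * (j - k))
      + b k * cosKernel m w 2 (m * (j - k))) = v' j)
    {εa εb r2 : ℝ} (ha : ∀ k, ‖a k - ω k‖ ≤ εa) (hb : ∀ k, ‖b k‖ ≤ εb)
    (hrest : ∀ (x : ℝ) (j : T), m * wrapDist x j ≤ 0.16749 →
      ‖∑ k ∈ Finset.univ.erase j, (a k * cosKernel m w 2 (m * (x - k))
        + b k * cosKernel m w 3 (m * (x - k)))‖ ≤ r2)
    (hre : -(0.484 - εa - 6.2832 * εb) * curvature m w + r2 ≤ -1)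
    (him : (εa + 6.2832 * εb) * curvature m w + r2 ≤ 0.63)
    (hnorm : (1 + εa + 6.2832 * εb) * curvature m w + r2 ≤ 21)
    (hfar : ∀ x, (∀ t ∈ T, 0.16749 / (m : ℝ) < wrapDist x t) →
      ‖hermiteSum m w a b 0 x‖ ≤ 0.985) :
    IsPeakInterpolant m T ω v v' (hermiteSum m w a b 0) (hermiteSum m w a b 1)
      (hermiteSum m w a b 2) where
  isTrigPoly := isTrigPoly_hermiteSum hm a b
  hasDerivAt := hasDerivAt_hermiteSum a b 0
  hasDerivAt_one := hasDerivAt_hermiteSum a b 1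
  apply_node t ht := hv ⟨t, ht⟩
  one_apply_node t ht := hv' ⟨t, ht⟩
  near t ht u hu := by
    have hmr : (0 : ℝ) < m := by exact_mod_cast hm
    set j : T := ⟨t, ht⟩ with hj
    have hx : m * (t + u / m - t) = u := by field_simp; ring
    have hd : m * wrapDist (t + u / m) t ≤ 0.16749 := by
      have h1 := wrapDist_le_abs_sub (t + u / m) t 0
      rw [Int.cast_zero, sub_zero, add_sub_cancel_left, abs_div, Nat.abs_cast,
        le_div_iff₀' hmr] at h1
      exact h1.trans hu
    set c := starRingEnd ℂ (ω t) with hc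
    have hcn : ‖c‖ = 1 := by rw [hc, RCLike.norm_conj, hω t ht]
    have hcω : c * ω t = 1 := by
      rw [mul_comm, hc, Complex.mul_conj, Complex.normSq_eq_norm_sq, hω t ht]
      norm_num
    set R := ∑ k ∈ Finset.univ.erase j, (a k * cosKernel m w 2 (m * (t + u / m - k))
        + b k * cosKernel m w 3 (m * (t + u / m - k)))
    have e : hermiteSum m w a b 2 (t + u / m)
        = a j * cosKernel m w 2 u + b j * cosKernel m w 3 u + R := by
      rw [hermiteSum, ← Finset.add_sum_erase _ _ (Finset.mem_univ j)]
      simp only [hj, hx]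
      rfl
    have e' : c * hermiteSum m w a b 2 (t + u / m)
        = (c * a j) * cosKernel m w 2 u + (c * b j) * cosKernel m w 3 u + c * R := by
      rw [e]; ring
    have hα : ‖c * a j - 1‖ ≤ εa := by
      rw [← hcω, ← mul_sub, norm_mul, hcn, one_mul]
      exact ha j
    have hβ : ‖c * b j‖ ≤ εb := by
      rw [norm_mul, hcn, one_mul]
      exact hb j
    have hR : ‖c * R‖ ≤ r2 := by
      rw [norm_mul, hcn, one_mul]
      exact hrest _ j hd
    obtain ⟨h1, h2, h3⟩ := second_deriv_near_node hm hw hα hβ hR hu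
    rw [← e'] at h1 h2 h3
    rw [norm_mul, hcn, one_mul] at h3
    exact ⟨h1.trans hre, h2.trans him, h3.trans hnorm⟩
  far := hfar

theorem cosKernel_zero_le_one_sub (hm : 0 < m) (hw : ∀ k, 0 ≤ w k)
    (hw1 : ∑ k ∈ Finset.range (m + 1), w k = 1) {u : ℝ} (hu : |u| ≤ 0.25) :
    cosKernel m w 0 u
      ≤ 1 - (1 - (2 * Real.pi * u) ^ 2 / 24) ^ 2 * curvature m w * u ^ 2 / 2 :=
  cosSum_zero_le_one_sub (fun k _ => hw k) hw1 (freq_le_two_pi hm)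
    (by nlinarith [Real.pi_lt_d4, abs_nonneg u])

theorem exists_isPeakInterpolant_of_le_nine (hm : 1 ≤ m) (hm9 : m ≤ 9)
    (hsep : ∀ s ∈ T, ∀ t ∈ T, s ≠ t → 5 / (m : ℝ) ≤ wrapDist s t) {ω v v' : ℝ → ℂ}
    (hω : ∀ t ∈ T, ‖ω t‖ = 1) (hv : ∀ t ∈ T, ‖v t - ω t‖ ≤ 1 / 1000)
    (hv' : ∀ t ∈ T, ‖v' t‖ ≤ 1 / 1000) :
    ∃ q q1 q2 : ℝ → ℂ, IsPeakInterpolant m T ω v v' q q1 q2 := by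
  have hm0 : 0 < m := hm
  have hmr : (0 : ℝ) < m := by exact_mod_cast hm
  have hmr9 : (m : ℝ) ≤ 9 := by exact_mod_cast hm9
  obtain ⟨w, hw, hw1, hM0, hM1, hpos, hmono⟩ := exists_cosKernel_small hm hm9
  -- A separation of `5 / m` exceeds the diameter `1 / 2` of the circle.
  have hsub : ∀ j k : T, k = j := fun j k => by
    by_contra h
    have h1 := hsep k k.2 j j.2 fun h' => h (Subtype.ext h')
    rw [div_le_iff₀ hmr] at h1
    nlinarith [wrapDist_le_half k j]
  have herase : ∀ j : T, Finset.univ.erase j = ∅ := fun j => by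
    ext k
    simp [hsub j k]
  obtain ⟨a, b, ea, eb, ha, hb⟩ := exists_hermite_solution
    (fun j k : T => cosKernel m w 0 (m * ((j : ℝ) - k)))
    (fun j k : T => cosKernel m w 1 (m * ((j : ℝ) - k)))
    (fun j k : T => cosKernel m w 2 (m * ((j : ℝ) - k)))
    (M := curvature m w) (S0 := 0) (S1 := 0) (S2 := 0)
    (fun j => by simp [cosKernel_zero_apply_zero, hw1])
    (fun j => by rw [sub_self, mul_zero]; exact cosSum_one_apply_zero)
    (fun j => by rw [sub_self, mul_zero, cosKernel_two_apply_zero]) (by linarith)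
    (fun j => by rw [herase, Finset.sum_empty]) (fun j => by rw [herase, Finset.sum_empty])
    (fun j => by rw [herase, Finset.sum_empty])
    (fun A B hA hB h1 h2 => ⟨by linarith, by nlinarith⟩)
    (fun j => v j) (fun j => v' j)
  have hv'n : ‖fun j : T => v' j‖ ≤ 1 / 1000 :=
    (pi_norm_le_iff_of_nonneg (by norm_num)).2 fun j => hv' j j.2
  have ha' : ∀ k : T, ‖a k - ω k‖ ≤ 0.001 := fun k => by
    have h1 := (ha k).trans_eq (by ring : _ = (0 : ℝ))
    have h2 := norm_sub_le_norm_sub_add_norm_sub (a k) (v k) (ω k)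
    linarith [hv k k.2]
  have hb' : ∀ k, ‖b k‖ ≤ 0.0005 := fun k => by
    have h1 := hb k
    have := norm_nonneg (b k)
    norm_num at h1 hv'n ⊢
    nlinarith
  have hK : ∀ u : ℝ, 0.16749 ≤ |u| → |u| ≤ m / 2 → |cosKernel m w 0 u| ≤ 0.975 := fun u h1 h2 => by
    rw [abs_of_nonneg (hpos u)]
    have hth : |(0.16749 : ℝ)| = 0.16749 := abs_of_pos (by norm_num)
    have h3 := cosKernel_zero_le_one_sub hm0 hw hw1 (u := 0.16749) (by norm_num [hth])
    have h4 := hmono u 0.16749 (by rwa [hth]) h2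
    have h5 : (2 * Real.pi * 0.16749) ^ 2 ≤ 1.1076 := by nlinarith [Real.pi_lt_d4, Real.pi_pos]
    have h6 : (0.95385 : ℝ) ^ 2 ≤ (1 - (2 * Real.pi * 0.16749) ^ 2 / 24) ^ 2 :=
      pow_le_pow_left₀ (by norm_num) (by linarith) 2
    have h7 := mul_le_mul h6 hM0 (by norm_num) (sq_nonneg _)
    norm_num at h7 h3 h4 ⊢
    linarith
  refine ⟨_, _, _, isPeakInterpolant_hermiteSum hm0 hw hω ea eb ha' hb' (r2 := 0)
    (fun x j _ => by rw [herase, Finset.sum_empty, norm_zero])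
    (by norm_num; linarith) (by norm_num; linarith) (by norm_num; linarith) (fun x hx => ?_)⟩
  rcases isEmpty_or_nonempty T with hT | ⟨⟨j⟩⟩
  · norm_num [hermiteSum]
  · rw [hermiteSum, ← Finset.add_sum_erase _ _ (Finset.mem_univ j), herase, Finset.sum_empty,
      add_zero]
    obtain ⟨u, hu, hk⟩ := exists_abs_eq_wrapDist hm0 x (j : ℝ)
    have h1 := hx j j.2
    rw [div_lt_iff₀' hmr, ← hu] at h1
    have h2 := hK u h1.le (by rw [hu]; nlinarith [wrapDist_le_half x j])
    have h3 : |cosKernel m w 1 u| ≤ 6 :=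
      (abs_cosSum_one_le (fun k _ => hw k) hw1 u).trans (by
        have : curvature m w / 4 + 1 ≤ 6 := by linarith
        exact this)
    have h4 : ‖a j‖ ≤ 1.001 := by
      have h5 := norm_sub_norm_le (a j) (ω j)
      rw [hω j j.2] at h5
      linarith [ha' j]
    rw [hk, hk]
    refine (norm_add_le _ _).trans ?_
    rw [norm_mul, norm_mul, Complex.norm_real, Complex.norm_real, Real.norm_eq_abs,
      Real.norm_eq_abs]
    have h5 := mul_le_mul h4 h2 (abs_nonneg _) (by norm_num)
    have h6 := mul_le_mul (hb' j) h3 (abs_nonneg _) (by norm_num)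
    norm_num at h5 h6 ⊢
    linarith

/-- In the rescaled variable the nodes are at mutual distance at least `5`. The bound off the nodes is
proved separately in four ranges of the distance `|u|` from the closest node: the first two rest on
the monotonicity of the kernel, the others on its decay. -/
theorem exists_isPeakInterpolant_of_ten_le (hm : 10 ≤ m)
    (hsep : ∀ s ∈ T, ∀ t ∈ T, s ≠ t → 5 / (m : ℝ) ≤ wrapDist s t) {ω v v' : ℝ → ℂ}
    (hω : ∀ t ∈ T, ‖ω t‖ = 1) (hv : ∀ t ∈ T, ‖v t - ω t‖ ≤ 1 / 1000)
    (hv' : ∀ t ∈ T, ‖v' t‖ ≤ 1 / 1000) :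
    ∃ q q1 q2 : ℝ → ℂ, IsPeakInterpolant m T ω v v' q q1 q2 := by
  have hm0 : 0 < m := by omega
  have hmr : (0 : ℝ) < m := by exact_mod_cast hm0
  obtain ⟨w, hw, hw1, hM0, hM1, hpos, hmono, hdecay⟩ := exists_cosKernel_decay hm
  have tail0 : ∀ {α : ℝ}, 0 < α → ∀ (x : ℝ) (S : Finset T), (∀ k ∈ S, α ≤ m * wrapDist x k) →
      ∑ k ∈ S, |cosKernel m w 0 (m * (x - k))|
        ≤ 1 * (2 * (1 / α ^ 4 + 1 / (15 * (α + 2.5) ^ 3))) := fun hα =>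
    sum_abs_cosKernel_le hm0 hsep hα zero_le_one fun u τ hτ _ => (hdecay u τ hτ).1
  have tail1 : ∀ {α : ℝ}, 2.5 ≤ α → ∀ (x : ℝ) (S : Finset T), (∀ k ∈ S, α ≤ m * wrapDist x k) →
      ∑ k ∈ S, |cosKernel m w 1 (m * (x - k))|
        ≤ 8.8 * (2 * (1 / α ^ 4 + 1 / (15 * (α + 2.5) ^ 3))) := fun hα =>
    sum_abs_cosKernel_le hm0 hsep (by linarith) (by norm_num)
      fun u τ hτ h => (hdecay u τ hτ).2.1 (hα.trans h)
  have tail2 : ∀ {α : ℝ}, 4.83 ≤ α → ∀ (x : ℝ) (S : Finset T), (∀ k ∈ S, α ≤ m * wrapDist x k) →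
      ∑ k ∈ S, |cosKernel m w 2 (m * (x - k))|
        ≤ 60.6 * (2 * (1 / α ^ 4 + 1 / (15 * (α + 2.5) ^ 3))) := fun hα =>
    sum_abs_cosKernel_le hm0 hsep (by linarith) (by norm_num)
      fun u τ hτ h => ((hdecay u τ hτ).2.2 (hα.trans h)).1
  have tail3 : ∀ {α : ℝ}, 4.83 ≤ α → ∀ (x : ℝ) (S : Finset T), (∀ k ∈ S, α ≤ m * wrapDist x k) →
      ∑ k ∈ S, |cosKernel m w 3 (m * (x - k))|
        ≤ 502 * (2 * (1 / α ^ 4 + 1 / (15 * (α + 2.5) ^ 3))) := fun hα =>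
    sum_abs_cosKernel_le hm0 hsep (by linarith) (by norm_num)
      fun u τ hτ h => ((hdecay u τ hτ).2.2 (hα.trans h)).2
  have others : ∀ {x d : ℝ} {j : T}, m * wrapDist x j ≤ d →
      ∀ k ∈ Finset.univ.erase j, 5 - d ≤ m * wrapDist x k := fun hd k hk =>
    le_wrapDist_of_ne hm0 hsep (Finset.ne_of_mem_erase hk) hd
  have hself : ∀ j : T, m * wrapDist j j ≤ 0 := fun j => by simp [wrapDist]
  -- The row sums are the tail bounds at `α = 5`, the rescaled distance between nodes.
  obtain ⟨a, b, ea, eb, ha, hb⟩ := exists_hermite_solution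
    (fun j k : T => cosKernel m w 0 (m * ((j : ℝ) - k)))
    (fun j k : T => cosKernel m w 1 (m * ((j : ℝ) - k)))
    (fun j k : T => cosKernel m w 2 (m * ((j : ℝ) - k)))
    (M := curvature m w) (S0 := 0.003517) (S1 := 0.03096) (S2 := 0.2132)
    (fun j => by simp [cosKernel_zero_apply_zero, hw1])
    (fun j => by rw [sub_self, mul_zero]; exact cosSum_one_apply_zero)
    (fun j => by rw [sub_self, mul_zero, cosKernel_two_apply_zero]) (by linarith)
    (fun j => (tail0 (by norm_num) _ _ (others (hself j))).trans (by norm_num))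
    (fun j => (tail1 (by norm_num) _ _ (others (hself j))).trans (by norm_num))
    (fun j => (tail2 (by norm_num) _ _ (others (hself j))).trans (by norm_num))
    (fun A B hA hB h1 h2 => by
      have h3 := mul_le_mul_of_nonneg_right hM0 hB
      constructor <;> linarith)
    (fun j => v j) (fun j => v' j)
  have hv'n : ‖fun j : T => v' j‖ ≤ 1 / 1000 :=
    (pi_norm_le_iff_of_nonneg (by norm_num)).2 fun j => hv' j j.2
  have hA0 := norm_nonneg a
  have hB0 := norm_nonneg b
  have hB : 3.289 * ‖b‖ ≤ 1 / 1000 + 0.03096 * ‖a‖ + 0.2132 * ‖b‖ := by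
    have h1 : ∀ k, ‖b k‖ ≤ (1 / 1000 + 0.03096 * ‖a‖ + 0.2132 * ‖b‖) / 3.289 := fun k => by
      rw [le_div_iff₀' (by norm_num)]
      have h2 := mul_le_mul_of_nonneg_right hM0 (norm_nonneg (b k))
      linarith [hb k]
    rw [← le_div_iff₀' (by norm_num)]
    exact (pi_norm_le_iff_of_nonneg (by positivity)).2 h1
  have hA : ‖a‖ ≤ 1.001 + 0.003517 * ‖a‖ + 0.03096 * ‖b‖ := by
    refine (pi_norm_le_iff_of_nonneg (by positivity)).2 fun k => ?_
    have h1 := norm_sub_norm_le (a k) (v k)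
    have h2 := norm_sub_norm_le (v k) (ω k)
    have h3 := hv k k.2
    rw [hω k k.2] at h2
    linarith [ha k]
  have hA' : ‖a‖ ≤ 1.005 := by linarith
  have hB' : ‖b‖ ≤ 0.0105 := by linarith
  have hak : ∀ k, ‖a k‖ ≤ 1.005 := fun k => (norm_le_pi_norm a k).trans hA'
  have hbk : ∀ k, ‖b k‖ ≤ 0.0105 := fun k => (norm_le_pi_norm b k).trans hB'
  have haω : ∀ k : T, ‖a k - ω k‖ ≤ 0.005 := fun k => by
    have h1 := norm_sub_le_norm_sub_add_norm_sub (a k) (v k) (ω k)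
    linarith [ha k, hv k k.2]
  -- The factor is `1.005 * 1 + 0.0105 * 8.8`.
  have tail : ∀ {α κ : ℝ}, 2.5 ≤ α → 2 * (1 / α ^ 4 + 1 / (15 * (α + 2.5) ^ 3)) ≤ κ →
      ∀ (x : ℝ) (S : Finset T), (∀ k ∈ S, α ≤ m * wrapDist x k) →
      ‖∑ k ∈ S, (a k * cosKernel m w 0 (m * (x - k)) + b k * cosKernel m w 1 (m * (x - k)))‖
        ≤ 1.0974 * κ := fun hα hκ x S hS => by
    have := norm_sum_mul_le S hak hbk (by norm_num) (by norm_num) (tail0 (by linarith) x S hS)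
      (tail1 hα x S hS)
    linarith
  have hpi0 := Real.pi_lt_d4
  have hpipos := Real.pi_pos
  -- The value at `0.16749` bounds the kernel beyond that point, and likewise that at `0.25`.
  have hK1 : ∀ u : ℝ, 0.16749 ≤ |u| → |u| ≤ 1.35 → cosKernel m w 0 u ≤ 0.9581 := fun u h1 h2 => by
    have hth : |(0.16749 : ℝ)| = 0.16749 := abs_of_pos (by norm_num)
    have h3 := cosKernel_zero_le_one_sub hm0 hw hw1 (u := 0.16749) (by norm_num [hth])
    have h4 := hmono u 0.16749 (by rwa [hth]) (by rw [hth]; norm_num at h2 ⊢; linarith)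
    have h5 : (2 * Real.pi * 0.16749) ^ 2 ≤ 1.1076 := by nlinarith
    have h6 : (0.95385 : ℝ) ^ 2 ≤ (1 - (2 * Real.pi * 0.16749) ^ 2 / 24) ^ 2 :=
      pow_le_pow_left₀ (by norm_num) (by linarith) 2
    have h7 := mul_le_mul h6 hM0 (by norm_num) (sq_nonneg _)
    norm_num at h7 h3 h4 ⊢
    linarith
  have hK2 : ∀ u : ℝ, 0.25 ≤ |u| → |u| ≤ 1.35 → cosKernel m w 0 u ≤ 0.918 := fun u h1 h2 => by
    have hth : |(0.25 : ℝ)| = 0.25 := abs_of_pos (by norm_num)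
    have h3 := cosKernel_zero_le_one_sub hm0 hw hw1 (u := 0.25) (by norm_num [hth])
    have h4 := hmono u 0.25 (by rwa [hth]) (by rw [hth]; norm_num at h2 ⊢; linarith)
    have h5 : (2 * Real.pi * 0.25) ^ 2 ≤ 2.4675 := by nlinarith
    have h6 : (0.8971 : ℝ) ^ 2 ≤ (1 - (2 * Real.pi * 0.25) ^ 2 / 24) ^ 2 :=
      pow_le_pow_left₀ (by norm_num) (by linarith) 2
    have h7 := mul_le_mul h6 hM0 (by norm_num) (sq_nonneg _)
    norm_num at h7 h3 h4 ⊢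
    linarith
  refine ⟨_, _, _, isPeakInterpolant_hermiteSum hm0 hw hω ea eb haω hbk (r2 := 0.267)
    (fun x j hj => ?_) (by norm_num; linarith) (by norm_num; linarith)
    (by norm_num; linarith) (fun x hx => ?_)⟩
  · have hS := others hj
    have := norm_sum_mul_le _ hak hbk (by norm_num) (by norm_num) (tail2 (by norm_num) x _ hS)
      (tail3 (by norm_num) x _ hS)
    norm_num at this ⊢
    linarith
  -- A node `j` is singled out, and all others are at rescaled distance at least `α`.
  have peak : ∀ (j : T) {α κ κ0 κ1 : ℝ}, 2.5 ≤ α →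
      2 * (1 / α ^ 4 + 1 / (15 * (α + 2.5) ^ 3)) ≤ κ →
      (∀ k ∈ Finset.univ.erase j, α ≤ m * wrapDist x k) →
      |cosKernel m w 0 (m * (x - j))| ≤ κ0 → |cosKernel m w 1 (m * (x - j))| ≤ κ1 →
      ‖hermiteSum m w a b 0 x‖ ≤ 1.005 * κ0 + 0.0105 * κ1 + 1.0974 * κ := by
    intro j α κ κ0 κ1 hα hκ hS h0 h1
    rw [hermiteSum, ← Finset.add_sum_erase _ _ (Finset.mem_univ j)]
    refine (norm_add_le _ _).trans (add_le_add ((norm_add_le _ _).trans ?_) (tail hα hκ x _ hS))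
    rw [norm_mul, norm_mul, Complex.norm_real, Complex.norm_real, Real.norm_eq_abs,
      Real.norm_eq_abs]
    exact add_le_add (mul_le_mul (hak j) h0 (abs_nonneg _) (by norm_num))
      (mul_le_mul (hbk j) h1 (abs_nonneg _) (by norm_num))
  by_cases hnear : ∃ j : T, m * wrapDist x j ≤ 2.5
  · obtain ⟨j, hj⟩ := hnear
    obtain ⟨u, hu, hk⟩ := exists_abs_eq_wrapDist hm0 x (j : ℝ)
    have hu1 := hx j j.2
    rw [div_lt_iff₀' hmr, ← hu] at hu1
    rw [← hu] at hj
    have b0 : |cosKernel m w 1 u| ≤ 2.1525 :=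
      (abs_cosSum_one_le (fun k _ => hw k) hw1 u).trans (by
        have : curvature m w / 4 + 1 ≤ 2.1525 := by norm_num; linarith
        exact this)
    rcases le_total |u| 0.25 with hu2 | hu2
    · have b1 : |cosKernel m w 1 u| ≤ 1.1525 :=
        (abs_cosSum_one_le_mul_abs (fun k _ => hw k) u).trans (by
          have : curvature m w * |u| ≤ 4.61 * 0.25 :=
            mul_le_mul hM1 hu2 (abs_nonneg _) (by norm_num)
          norm_num at this ⊢
          exact this)
      have b2 := hK1 u hu1.le (hu2.trans (by norm_num))
      refine (peak j (α := 5 - 0.25) (κ := 0.0043) (κ0 := 0.9581) (κ1 := 1.1525)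
        (by norm_num) (by norm_num)
        (others (by rw [← hu]; exact hu2))
        (by rw [hk, abs_of_nonneg (hpos u)]; exact b2) (by rw [hk]; exact b1)).trans (by norm_num)
    · rcases le_total |u| 1.35 with hu3 | hu3
      · have b2 := hK2 u hu2 hu3
        refine (peak j (α := 5 - 1.35) (κ := 0.0119) (κ0 := 0.918) (κ1 := 2.1525)
          (by norm_num) (by norm_num) (others (by rw [← hu]; exact hu3))
          (by rw [hk, abs_of_nonneg (hpos u)]; exact b2) (by rw [hk]; exact b0)).trans
          (by norm_num)
      · have b2 : |cosKernel m w 0 (m * (x - j))| ≤ 0.61 := by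
          have := tail0 (α := 1.35) (by norm_num) x {j} (fun k hk => by
            rw [Finset.mem_singleton.1 hk, ← hu]
            exact hu3)
          rw [Finset.sum_singleton] at this
          exact this.trans (by norm_num)
        refine (peak j (α := 5 - 2.5) (κ := 0.0523) (κ0 := 0.61) (κ1 := 2.1525) (by norm_num)
          (by norm_num) (others (by rw [← hu]; exact hj)) b2 (by rw [hk]; exact b0)).trans
          (by norm_num)
  · push Not at hnear
    refine (tail (κ := 0.0523) le_rfl (by norm_num) x Finset.univ fun k _ => (hnear k).le).trans
      (by norm_num)

end PeakInterpolant

/-! ### Multiplication by a wide window -/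

/-- Let `q` interpolate the values `v` and slopes `v'` for which the product of `q` with the window
`sinc (c * x)` has values `ω` and slopes zero at the nodes. For small `c` the product inherits
from `q` the quadratic peak in modulus at each node. -/
theorem IsPeakInterpolant.norm_mul_sinc_le {m : ℕ} (hm : 1 ≤ m) {T : Finset ℝ}
    {ω v v' q q1 q2 : ℝ → ℂ} (h : IsPeakInterpolant m T ω v v' q q1 q2) {t : ℝ} (ht : t ∈ T)
    (htabs : |t| ≤ 1 / 2) (hω : ‖ω t‖ = 1) {c : ℝ} (hc0 : 0 ≤ c) (hc : c ≤ 0.0005)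
    (hv : v t = ω t / Real.sinc (c * t))
    (hv' : v' t = -(ω t * ((c / m * sincDeriv (c * t) : ℝ) : ℂ)) / (Real.sinc (c * t) : ℂ) ^ 2)
    (hvn : ‖v t‖ ≤ 1.001) (hvn' : ‖v' t‖ ≤ 0.001) {u : ℝ} (hu : |u| ≤ 0.16749) :
    ‖q (t + u / m) * Real.sinc (c * (t + u / m))‖ ≤ 1 - 0.35 * u ^ 2 := by
  have hmr : (1 : ℝ) ≤ m := by exact_mod_cast hm
  have hm0 : (m : ℝ) ≠ 0 := by positivity
  have hm0c : (m : ℂ) ≠ 0 := by exact_mod_cast hm0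
  have hlin : ∀ u : ℝ, HasDerivAt (fun u : ℝ => t + u / m) (1 / m) u := fun u =>
    ((hasDerivAt_id u).div_const (m : ℝ)).const_add t
  have hq : ∀ u : ℝ, HasDerivAt (fun u : ℝ => q (t + u / m)) (q1 (t + u / m)) u := fun u => by
    refine ((h.hasDerivAt (t + u / m)).scomp u (hlin u)).congr_deriv ?_
    rw [Complex.real_smul]
    push_cast
    field_simp
  have hq1 : ∀ u : ℝ, HasDerivAt (fun u : ℝ => q1 (t + u / m)) (q2 (t + u / m)) u := fun u => by
    refine ((h.hasDerivAt_one (t + u / m)).scomp u (hlin u)).congr_deriv ?_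
    rw [Complex.real_smul]
    push_cast
    field_simp
  have hclin : ∀ u : ℝ, HasDerivAt (fun u : ℝ => c * (t + u / m)) (c / m) u := fun u =>
    ((hlin u).const_mul c).congr_deriv (by ring)
  have hs : ∀ u : ℝ, HasDerivAt (fun u : ℝ => (Real.sinc (c * (t + u / m)) : ℂ))
      ((c / m * sincDeriv (c * (t + u / m)) : ℝ) : ℂ) u := fun u =>
    (((hasDerivAt_sinc _).comp u (hclin u)).congr_deriv (by ring)).ofReal_comp
  have hs1 : ∀ u : ℝ, HasDerivAt (fun u : ℝ => ((c / m * sincDeriv (c * (t + u / m)) : ℝ) : ℂ))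
      (((c / m) ^ 2 * sincDeriv2 (c * (t + u / m)) : ℝ) : ℂ) u := fun u =>
    ((((hasDerivAt_sincDeriv _).comp u (hclin u)).const_mul (c / m)).congr_deriv
      (by ring)).ofReal_comp
  have hcm : c / m ≤ c := div_le_self hc0 hmr
  have hcm0 : 0 ≤ c / m := by positivity
  have zero_mem : (0 : ℝ) ∈ Set.Icc (-0.16749 : ℝ) 0.16749 := by constructor <;> norm_num
  have mem : ∀ {u : ℝ}, |u| ≤ 0.16749 → u ∈ Set.Icc (-0.16749 : ℝ) 0.16749 :=
    fun hu => abs_le.1 hu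
  have bq2 : ∀ u : ℝ, |u| ≤ 0.16749 → ‖q2 (t + u / m)‖ ≤ 21 := fun u hu => (h.near t ht u hu).2.2
  have bq1 : ∀ u : ℝ, |u| ≤ 0.16749 → ‖q1 (t + u / m)‖ ≤ 4 := fun u hu => by
    have h1 := Convex.norm_image_sub_le_of_norm_hasDerivWithin_le
      (fun u _ => (hq1 u).hasDerivWithinAt) (fun u hu => bq2 u (abs_le.2 hu))
      (convex_Icc (-0.16749 : ℝ) 0.16749) zero_mem (mem hu)
    simp only [zero_div, add_zero, sub_zero, h.one_apply_node t ht, Real.norm_eq_abs] at h1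
    have h2 := norm_sub_norm_le (q1 (t + u / m)) (v' t)
    linarith
  have bq : ∀ u : ℝ, |u| ≤ 0.16749 → ‖q (t + u / m)‖ ≤ 2 := fun u hu => by
    have h1 := Convex.norm_image_sub_le_of_norm_hasDerivWithin_le
      (fun u _ => (hq u).hasDerivWithinAt) (fun u hu => bq1 u (abs_le.2 hu))
      (convex_Icc (-0.16749 : ℝ) 0.16749) zero_mem (mem hu)
    simp only [zero_div, add_zero, sub_zero, h.apply_node t ht, Real.norm_eq_abs] at h1
    have h2 := norm_sub_norm_le (q (t + u / m)) (v t)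
    linarith
  have bs : ∀ u : ℝ, |u| ≤ 0.16749 → ‖(Real.sinc (c * (t + u / m)) : ℂ) - 1‖ ≤ c := fun u hu => by
    have h1 := one_sub_abs_le_sinc (c * (t + u / m))
    have h2 := Real.sinc_le_one (c * (t + u / m))
    have h3 : |c * (t + u / m)| ≤ c := by
      rw [abs_mul, abs_of_nonneg hc0]
      refine mul_le_of_le_one_right hc0 ((abs_add_le _ _).trans ?_)
      have h4 : |u / m| ≤ |u| := by
        rw [abs_div, Nat.abs_cast]
        exact div_le_self (abs_nonneg u) hmr
      norm_num at hu
      linarith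
    rw [← Complex.ofReal_one, ← Complex.ofReal_sub, Complex.norm_real, Real.norm_eq_abs, abs_le]
    constructor <;> linarith
  have bs1 : ∀ u : ℝ, ‖((c / m * sincDeriv (c * (t + u / m)) : ℝ) : ℂ)‖ ≤ c := fun u => by
    rw [Complex.norm_real, Real.norm_eq_abs, abs_mul, abs_of_nonneg hcm0]
    exact (mul_le_of_le_one_right hcm0 (abs_sincDeriv_le _)).trans hcm
  have bs2 : ∀ u : ℝ, ‖(((c / m) ^ 2 * sincDeriv2 (c * (t + u / m)) : ℝ) : ℂ)‖ ≤ c := fun u => by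
    rw [Complex.norm_real, Real.norm_eq_abs, abs_mul, abs_of_nonneg (sq_nonneg _)]
    refine (mul_le_of_le_one_right (sq_nonneg _) (abs_sincDeriv2_le _)).trans ?_
    nlinarith
  set F2 : ℝ → ℂ := fun u => q2 (t + u / m) * (Real.sinc (c * (t + u / m)) : ℂ)
    + 2 * q1 (t + u / m) * ((c / m * sincDeriv (c * (t + u / m)) : ℝ) : ℂ)
    + q (t + u / m) * (((c / m) ^ 2 * sincDeriv2 (c * (t + u / m)) : ℝ) : ℂ) with hF2
  have close : ∀ u : ℝ, |u| ≤ 0.16749 → ‖F2 u - q2 (t + u / m)‖ ≤ 0.0155 := fun u hu => by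
    have e : F2 u - q2 (t + u / m) = q2 (t + u / m) * ((Real.sinc (c * (t + u / m)) : ℂ) - 1)
        + 2 * q1 (t + u / m) * ((c / m * sincDeriv (c * (t + u / m)) : ℝ) : ℂ)
        + q (t + u / m) * (((c / m) ^ 2 * sincDeriv2 (c * (t + u / m)) : ℝ) : ℂ) := by
      rw [hF2]; ring
    rw [e]
    refine norm_add₃_le.trans ?_
    rw [norm_mul, norm_mul, norm_mul, norm_mul, Complex.norm_ofNat]
    have i1 := mul_le_mul (bq2 u hu) (bs u hu) (norm_nonneg _) (by norm_num)
    have i2 := mul_le_mul (bq1 u hu) (bs1 u) (norm_nonneg _) (by norm_num)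
    have i3 := mul_le_mul (bq u hu) (bs2 u) (norm_nonneg _) (by norm_num)
    linarith
  have hs0 : (Real.sinc (c * t) : ℂ) ≠ 0 := by
    have h1 := bs 0 (by norm_num)
    simp only [zero_div, add_zero] at h1
    intro h2
    rw [h2] at h1
    norm_num at h1
    linarith
  set ζ := starRingEnd ℂ (ω t) with hζ
  have hζn : ‖ζ‖ = 1 := by rw [hζ, RCLike.norm_conj, hω]
  have rot : ∀ u : ℝ, |u| ≤ 0.16749 → ‖ζ * F2 u - ζ * q2 (t + u / m)‖ ≤ 0.0155 := fun u hu => by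
    rw [← mul_sub, norm_mul, hζn, one_mul]
    exact close u hu
  refine norm_le_one_sub_sq hω (f := fun u : ℝ => q (t + u / m) * Real.sinc (c * (t + u / m)))
    (f1 := fun u : ℝ => q1 (t + u / m) * Real.sinc (c * (t + u / m))
      + q (t + u / m) * ((c / m * sincDeriv (c * (t + u / m)) : ℝ) : ℂ)) (f2 := F2)
    (fun u _ => (hq u).fun_mul (hs u)) (fun u _ => ?_) ?_ ?_ (fun u hu => ?_) (fun u hu => ?_)
    (fun u hu => ?_) hu
  · refine (((hq1 u).fun_mul (hs u)).fun_add ((hq u).fun_mul (hs1 u))).congr_deriv ?_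
    rw [hF2]
    ring
  · simp only [zero_div, add_zero, h.apply_node t ht, hv]
    field_simp
  · simp only [zero_div, add_zero, h.apply_node t ht, h.one_apply_node t ht, hv, hv']
    field_simp
    ring
  · have h1 := (Complex.abs_re_le_norm _).trans (rot u hu)
    rw [Complex.sub_re] at h1
    linarith [(h.near t ht u hu).1, le_abs_self ((ζ * F2 u).re - (ζ * q2 (t + u / m)).re)]
  · have h1 := (Complex.abs_im_le_norm _).trans (rot u hu)
    rw [Complex.sub_im] at h1
    linarith [(h.near t ht u hu).2.1,
      abs_sub_abs_le_abs_sub (ζ * F2 u).im (ζ * q2 (t + u / m)).im]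
  · have h1 := norm_sub_norm_le (F2 u) (q2 (t + u / m))
    linarith [close u hu, bq2 u hu]

theorem exists_pos_forall_abs_add_le {T : Finset ℝ}
    (hT : ∀ t ∈ T, t ∈ Set.Ioo (-(1 / 2) : ℝ) (1 / 2)) :
    ∃ δ : ℝ, 0 < δ ∧ ∀ t ∈ T, |t| + δ ≤ 1 / 2 := by
  rcases T.eq_empty_or_nonempty with rfl | hne
  · exact ⟨1, one_pos, by simp⟩
  · obtain ⟨t₀, ht₀, hmax⟩ := T.exists_max_image (fun t => |t|) hne
    exact ⟨1 / 2 - |t₀|, sub_pos.2 (abs_lt.2 (hT t₀ ht₀)), fun t ht => by linarith [hmax t ht]⟩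

theorem exists_isPeakInterpolant {m : ℕ} (hm : 1 ≤ m) {T : Finset ℝ}
    (hsep : ∀ s ∈ T, ∀ t ∈ T, s ≠ t → 5 / (m : ℝ) ≤ wrapDist s t) {ω v v' : ℝ → ℂ}
    (hω : ∀ t ∈ T, ‖ω t‖ = 1) (hv : ∀ t ∈ T, ‖v t - ω t‖ ≤ 1 / 1000)
    (hv' : ∀ t ∈ T, ‖v' t‖ ≤ 1 / 1000) :
    ∃ q q1 q2 : ℝ → ℂ, IsPeakInterpolant m T ω v v' q q1 q2 := by
  rcases le_or_gt m 9 with h9 | h9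
  · exact exists_isPeakInterpolant_of_le_nine hm h9 hsep hω hv hv'
  · exact exists_isPeakInterpolant_of_ten_le h9 hsep hω hv hv'

theorem mainTheorem5 (L : ℝ) (hL : 0 < L) (m : ℕ) (hm : 1 ≤ m)
    (T : Finset ℝ) (hT : ∀ t ∈ T, t ∈ Set.Ioo (-(1 / 2) : ℝ) (1 / 2))
    (hsep : ENNReal.ofReal (5 / (m : ℝ)) ≤ minSeparation T) :
    ∃ ρ₀ : ℝ, 0 < ρ₀ ∧ ∀ ρ : ℝ, 0 < ρ → ρ ≤ ρ₀ →
      ∀ ω : ℝ → ℂ, (∀ t ∈ T, ‖ω t‖ = 1) →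
        ∃ q : ℝ → ℂ, IsTrigPoly m q ∧
          (∀ t ∈ T, q t * (bandWindow L ρ t : ℂ) = ω t) ∧
          (∀ t ∈ T, ∀ x : ℝ, wrapDist x t ≤ 0.16749 / (m : ℝ) →
            ‖q x * (bandWindow L ρ x : ℂ)‖ ≤ 1 - 0.34 * (m : ℝ) ^ 2 * wrapDist x t ^ 2) ∧
          (∀ x : ℝ, (∀ t ∈ T, 0.16749 / (m : ℝ) < wrapDist x t) →
            ‖q x * (bandWindow L ρ x : ℂ)‖ ≤ 1 - 0.34 * 0.16749 ^ 2) := by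
  have hmr : (1 : ℝ) ≤ m := by exact_mod_cast hm
  have hm0 : (0 : ℝ) < m := by linarith
  have hsep' := le_wrapDist_of_le_minSeparation hsep
  obtain ⟨δ, hδ, hδT⟩ := exists_pos_forall_abs_add_le hT
  refine ⟨min 0.0005 (0.01 * (m * δ) ^ 2) * L / Real.pi, by
    have := Real.pi_pos
    have : (0 : ℝ) < min 0.0005 (0.01 * (m * δ) ^ 2) := lt_min (by norm_num) (by positivity)
    positivity, fun ρ hρ hρ₀ ω hω => ?_⟩
  set c := Real.pi * ρ / L with hc
  have hc0 : 0 < c := by rw [hc]; have := Real.pi_pos; positivity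
  have hcle : c ≤ min 0.0005 (0.01 * (m * δ) ^ 2) := by
    rw [le_div_iff₀ Real.pi_pos] at hρ₀
    rw [hc, div_le_iff₀ hL]
    linarith
  have hc1 : c ≤ 0.0005 := hcle.trans (min_le_left _ _)
  have hc2 : c ≤ 0.01 * (m * δ) ^ 2 := hcle.trans (min_le_right _ _)
  have htabs : ∀ t ∈ T, |t| ≤ 1 / 2 := fun t ht => by linarith [hδT t ht]
  have hs : ∀ y : ℝ, |y| ≤ 1 → 1 - c ≤ Real.sinc (c * y) := fun y hy => by
    have h1 := one_sub_abs_le_sinc (c * y)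
    rw [abs_mul, abs_of_pos hc0] at h1
    have := mul_le_of_le_one_right hc0.le hy
    linarith
  have hst : ∀ t ∈ T, 0.9995 ≤ Real.sinc (c * t) := fun t ht => by
    have := hs t (by linarith [htabs t ht])
    linarith
  set κ := Real.sqrt (ρ / (2 * L)) with hκ
  have hκ0 : 0 < κ := Real.sqrt_pos.2 (by positivity)
  have hκ0c : (κ : ℂ) ≠ 0 := by exact_mod_cast hκ0.ne'
  -- The values and slopes for which the product with the window has values `ω` and slopes zero.
  set v : ℝ → ℂ := fun t => ω t / Real.sinc (c * t) with hv
  set v' : ℝ → ℂ := fun t =>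
    -(ω t * ((c / m * sincDeriv (c * t) : ℝ) : ℂ)) / (Real.sinc (c * t) : ℂ) ^ 2 with hv'
  have hvω : ∀ t ∈ T, ‖v t - ω t‖ ≤ 1 / 1000 := fun t ht => by
    have h1 := hst t ht
    have h2 := Real.sinc_le_one (c * t)
    have h0 : (Real.sinc (c * t) : ℂ) ≠ 0 := by
      exact_mod_cast (by linarith : (0 : ℝ) < Real.sinc (c * t)).ne'
    have e : v t - ω t = ω t * (((1 - Real.sinc (c * t)) / Real.sinc (c * t) : ℝ) : ℂ) := by
      rw [hv]
      push_cast
      field_simp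
    rw [e, norm_mul, hω t ht, one_mul, Complex.norm_real, Real.norm_eq_abs,
      abs_of_nonneg (div_nonneg (by linarith) (by linarith)), div_le_iff₀ (by linarith)]
    linarith
  have hvn' : ∀ t ∈ T, ‖v' t‖ ≤ 1 / 1000 := fun t ht => by
    have h1 := hst t ht
    have h3 : |c / m * sincDeriv (c * t)| ≤ c := by
      rw [abs_mul, abs_of_nonneg (by positivity)]
      exact (mul_le_of_le_one_right (by positivity) (abs_sincDeriv_le _)).trans
        (div_le_self hc0.le hmr)
    rw [hv', norm_div, norm_neg, norm_mul, hω t ht, one_mul, norm_pow, Complex.norm_real,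
      Complex.norm_real, Real.norm_eq_abs, Real.norm_eq_abs, sq_abs, div_le_iff₀ (by positivity)]
    nlinarith
  obtain ⟨Q, Q1, Q2, hQ⟩ := exists_isPeakInterpolant hm hsep' hω hvω hvn'
  have hprod : ∀ x : ℝ, (κ : ℂ)⁻¹ * Q x * (bandWindow L ρ x : ℂ) = Q x * Real.sinc (c * x) := by
    intro x
    have e : Real.pi * ρ * x / L = c * x := by rw [hc]; ring
    rw [bandWindow, e, ← hκ]
    push_cast
    field_simp
  refine ⟨fun x => (κ : ℂ)⁻¹ * Q x, hQ.isTrigPoly.const_mul _, fun t ht => ?_,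
    fun t ht x hx => ?_, fun x hx => ?_⟩
  · have h1 := hst t ht
    have h0 : (Real.sinc (c * t) : ℂ) ≠ 0 := by
      exact_mod_cast (by linarith : (0 : ℝ) < Real.sinc (c * t)).ne'
    rw [hprod, hQ.apply_node t ht, hv]
    field_simp
  · rw [hprod]
    set n := round (x - t) with hn
    set y := x - n with hy
    set u := m * (y - t) with hu
    have hyt : |y - t| = wrapDist x t := by
      rw [wrapDist_eq, ← hn, hy]
      ring_nf
    have huabs : |u| = m * wrapDist x t := by rw [hu, abs_mul, Nat.abs_cast, hyt]
    have hu2 : u ^ 2 = (m : ℝ) ^ 2 * wrapDist x t ^ 2 := by rw [← sq_abs, huabs, mul_pow]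
    have hule : |u| ≤ 0.16749 := by
      rw [huabs]
      rwa [le_div_iff₀' hm0] at hx
    have hyu : t + u / m = y := by rw [hu]; field_simp; ring
    have hvt : ‖v t‖ ≤ 1.001 := by
      have h1 := norm_sub_norm_le (v t) (ω t)
      rw [hω t ht] at h1
      linarith [hvω t ht]
    have hvt' : ‖v' t‖ ≤ 0.001 := (hvn' t ht).trans (by norm_num)
    have hpeak := hQ.norm_mul_sinc_le hm ht (htabs t ht) (hω t ht) hc0.le hc1 rfl rfl
      hvt hvt' hule
    rw [hyu, norm_mul, Complex.norm_real, Real.norm_eq_abs] at hpeak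
    have hQxy : Q x = Q y := by
      rw [← hQ.isTrigPoly.apply_add_intCast y n, hy, sub_add_cancel]
    rw [hQxy, norm_mul, Complex.norm_real, Real.norm_eq_abs, mul_assoc, ← hu2]
    rcases le_or_gt |y| (1 / 2) with hy2 | hy2
    · -- Here `y` is the representative of `x` closest to zero, where the window is largest.
      have hxy : |y| ≤ |x| := by
        rcases eq_or_ne n 0 with h0 | h0
        · rw [hy, h0]; simp
        · have h1 : (1 : ℝ) ≤ |(n : ℝ)| := by exact_mod_cast Int.one_le_abs h0
          have h2 : |(n : ℝ)| ≤ |x| + |y| := by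
            rw [show (n : ℝ) = x - y by rw [hy]; ring]
            exact abs_sub _ _
          linarith
      have hle := abs_sinc_le_sinc (z := c * y) (z' := c * x)
        (by
          rw [abs_mul, abs_of_pos hc0]
          have := mul_le_mul_of_nonneg_left hy2 hc0.le
          norm_num at hc1
          linarith)
        (by
          rw [abs_mul, abs_mul]
          exact mul_le_mul_of_nonneg_left hxy (abs_nonneg c))
      have h1 := mul_le_mul_of_nonneg_left (hle.trans (le_abs_self _)) (norm_nonneg (Q y))
      have := sq_nonneg u
      linarith
    · -- Otherwise `y` is at distance at least `δ` from `t`, and the slack in the quadratic bound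
      -- absorbs the deviation of the window from `1`.
      have hyt2 : |y| ≤ |t| + |y - t| := by
        have := abs_add_le t (y - t)
        rwa [add_sub_cancel] at this
      have hδd : δ ≤ wrapDist x t := by
        rw [← hyt]
        linarith [hδT t ht]
      have hu3 : (m * δ) ^ 2 ≤ u ^ 2 := by
        rw [← sq_abs u, huabs]
        exact pow_le_pow_left₀ (by positivity) (mul_le_mul_of_nonneg_left hδd hm0.le) 2
      have hy1 : |y| ≤ 1 := by
        have := wrapDist_le_half x t
        have := htabs t ht
        linarith
      have h1 := hs y hy1
      have h2 : ‖Q y‖ * (1 - c) ≤ 1 - 0.35 * u ^ 2 :=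
        (mul_le_mul_of_nonneg_left (h1.trans (le_abs_self _)) (norm_nonneg _)).trans hpeak
      have h3 : ‖Q y‖ * |Real.sinc (c * x)| ≤ ‖Q y‖ :=
        mul_le_of_le_one_right (norm_nonneg _) (Real.abs_sinc_le_one _)
      refine h3.trans (le_of_mul_le_mul_right (h2.trans ?_) (by linarith : 0 < 1 - c))
      have h4 : 0 ≤ 0.34 * u ^ 2 * c := by positivity
      linarith
  · rw [hprod, norm_mul, Complex.norm_real, Real.norm_eq_abs]
    have h1 := mul_le_of_le_one_right (norm_nonneg (Q x)) (Real.abs_sinc_le_one (c * x))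
    have h2 := hQ.far x hx
    norm_num at h2 ⊢
    linarith
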